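/- Let $G(x)=\frac12e^{-|x|}$, so that $u=G*m$ solves $u-u_{xx}=m$. Let $k\ge 1$ be an integer and let $m_0\in C_c^k(\mathbb R)$, $u_0:=G*m_0$. Consider the Cauchy problem for the modified Camassa–Holm equation $$m_t+\big[(u^2-u_x^2)m\big]_x=0,\qquad m=u-u_{xx},\quad u=G*m,\qquad m(\cdot,0)=m_0 .$$ For $0\le T\le\infty$, a classical solution on $[0,T)$ is a pair $(u,m)$ satisfying this problem such that $\partial_x^ju$ $(j\le k+2)$, $\partial_x^jm$ $(j\le k)$, $\partial_tu$ and $\partial_tm$ exist and are continuous on $\mathbb R\times[0,T)$ and $m$ is bounded on $\mathbb R\times[0,\tau]$ for every $\tau<T$. Let $T_{max}(m_0)\in[0,\infty]$ be the maximal existence time, that is, the supremum of all $T$ for which a classical solution on $[0,T)$ exists. Then: (i) $$T_{max}(m_0)\ \ge\ \frac{1}{\|m_0\|_{L^\infty}\|m_0\|_{L^1}}$$ (with $1/0=+\infty$ if $m_0\equiv 0$). (ii) If there is a point $\bar\xi\in\mathbb R$ such that $$m_0(\bar\xi)\,\partial_xu_0(\bar\xi)<0\qquad\text{and}\qquad |m_0(\bar\xi)|\,\big(\partial_xu_0(\bar\xi)\big)^2>\tfrac12\|m_0\|_{L^1}^3,$$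 then the classical solution blows up in finite time: $T_{max}(m_0)<\infty$, a classical solution $(u,m)$ exists on $[0,T_{max}(m_0))$, and every such solution satisfies $\limsup_{t\to T_{max}(m_0)^-}\|m(\cdot,t)\|_{L^\infty}=+\infty$. Moreover, for such $m_0$ and every $\epsilon>0$, $$\frac{1}{\|m_0\|_{L^\infty}\|m_0\|_{L^1}}\cdot\frac1{\epsilon^2}\ \le\ T_{max}(\epsilon m_0)\ \le\ \frac{1}{\|m_0\|_{L^1}^2}\cdot\frac1{\epsilon^2}.$$ -/

import Mathlib

open MeasureTheory Filter Topology Set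
open scoped ENNReal

noncomputable section

namespace MCH

/-- The fundamental solution `G(x) = e^{-|x|} / 2` of the Helmholtz operator `1 - ∂ₓₓ`. -/
def G (x : ℝ) : ℝ := (1 / 2) * Real.exp (-|x|)

/-- The convolution `G * f`. -/
def helmholtzInv (f : ℝ → ℝ) (x : ℝ) : ℝ := ∫ y, G (x - y) * f y

/-- The half-open time interval `[0, T)`, with `0 ≤ T ≤ ∞`. -/
def timeInterval (T : ℝ≥0∞) : Set ℝ := {t | 0 ≤ t ∧ ENNReal.ofReal t < T}

/-- The space `C^k_n(ℝ × [0, T))`: the derivatives `∂ₓ^j f` (`j ≤ k`) and `∂ₜ^j f` (`j ≤ n`) exist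
and are jointly continuous on `ℝ × [0, T)`; time derivatives at `t = 0` are one-sided.
Functions are written `f x t`. -/
structure IsClassC (k n : ℕ) (T : ℝ≥0∞) (f : ℝ → ℝ → ℝ) : Prop where
  contDiff_space : ∀ t ∈ timeInterval T, ContDiff ℝ k (fun x => f x t)
  continuousOn_space : ∀ j ≤ k,
    ContinuousOn (fun p : ℝ × ℝ => iteratedDeriv j (fun x => f x p.2) p.1)
      (univ ×ˢ timeInterval T)
  contDiffOn_time : ∀ x, ContDiffOn ℝ n (fun t => f x t) (timeInterval T)
  continuousOn_time : ∀ j ≤ n,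
    ContinuousOn (fun p : ℝ × ℝ => iteratedDerivWithin j (fun t => f p.1 t) (timeInterval T) p.2)
      (univ ×ˢ timeInterval T)

/-- `(u, m)` is a classical solution on `ℝ × [0, T)` of the modified Camassa-Holm equation
`m_t + [(u² - u_x²) m]_x = 0`, `m = u - u_xx`, `u = G * m`, with `m(·, 0) = m₀`.
As usual for this equation, `m` is bounded on `ℝ × [0, τ]` for every `τ < T`
(this excludes solutions with mass entering from spatial infinity). -/
structure IsClassicalSolution (k : ℕ) (m₀ : ℝ → ℝ) (T : ℝ≥0∞) (u m : ℝ → ℝ → ℝ) : Prop where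
  regularity_u : IsClassC (k + 2) 1 T u
  regularity_m : IsClassC k 1 T m
  bounded : ∀ τ ∈ timeInterval T, ∃ C : ℝ, ∀ t ∈ Icc 0 τ, ∀ x, |m x t| ≤ C
  momentum : ∀ t ∈ timeInterval T, ∀ x, m x t = u x t - iteratedDeriv 2 (fun y => u y t) x
  velocity : ∀ t ∈ timeInterval T, ∀ x, u x t = helmholtzInv (fun y => m y t) x
  equation : ∀ t ∈ timeInterval T, 0 < t → ∀ x,
    deriv (fun s => m x s) t
      + deriv (fun y => ((u y t) ^ 2 - (deriv (fun z => u z t) y) ^ 2) * m y t) x = 0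
  initial : ∀ x, m x 0 = m₀ x

/-- The maximal existence time `T_max(m₀) ∈ [0, ∞]` of the classical solution. -/
def maxTime (k : ℕ) (m₀ : ℝ → ℝ) : ℝ≥0∞ :=
  sSup {T | ∃ u m : ℝ → ℝ → ℝ, IsClassicalSolution k m₀ T u m}

/-- The classical solution with initial datum `m₀` blows up in finite time: `T_max(m₀) < ∞`, the
solution exists on `[0, T_max)`, and `limsup_{t → T_max} ‖m(·, t)‖_{L^∞} = ∞`. -/
def BlowsUpInFiniteTime (k : ℕ) (m₀ : ℝ → ℝ) : Prop :=
  maxTime k m₀ < ∞ ∧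
  (∃ u m : ℝ → ℝ → ℝ, IsClassicalSolution k m₀ (maxTime k m₀) u m) ∧
  ∀ u m : ℝ → ℝ → ℝ, IsClassicalSolution k m₀ (maxTime k m₀) u m →
    limsup (fun t => eLpNorm (fun x => m x t) ∞ volume) (𝓝[<] (maxTime k m₀).toReal) = ∞

end MCH

end

/-!
Along the flow `X_t = u² - u_x²` of a solution, `X_ξ = w` and `m(X(ξ, t), t) w(ξ, t) = m₀(ξ)`. The
change of variables `y = X(θ, t)` turns `u + u_x` and `u - u_x` into the tails
`R = ∫_{θ > ξ} e^{X(ξ) - X(θ)} m₀(θ) dθ` and `L = ∫_{θ ≤ ξ} e^{X(θ) - X(ξ)} m₀(θ) dθ`, which involve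
the datum only, and since `(u² - u_x²)_x = 2 u_x m` the equation becomes `w_t = m₀ (R - L)`. With
`X(ξ) - X(θ)` replaced by `∫_θ^ξ |w|` this is an ordinary differential equation in the space of
bounded continuous functions with a bounded, globally Lipschitz right-hand side, so `w` exists for
all times (`exists_isStretch`).

As long as `w > 0`, the map `X` is a diffeomorphism, jointly regular in space and time
(`IsStretch.contDiffOn`, `IsStretch.contDiffOn_label`), and `m = m₀ / w` transported by it is a
classical solution (`IsStretch.isClassicalSolution`) with compact support in space. Any other
classical solution agrees with it (`IsClassicalSolution.momentum_unique`): along the characteristics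
of the other solution, which need no decay at infinity, the difference of the momenta obeys a
Gronwall inequality in the supremum norm, the lost derivative falling on the compactly supported
solution. At a first zero of `w` the momentum `m₀ / w` is unbounded, so the maximal existence time
is exactly the first time at which `w` vanishes somewhere (`IsStretch.pos_of_isClassicalSolution`),
and if it is finite then `m` blows up there (`IsStretch.blowsUp_of_maxTime_lt_top`).

Both estimates are now estimates for `w = 1 + m₀ ∫ (R - L)`. Let `M` be the `L¹` norm of `m₀`. Since
`|R - L| ≤ M`, `w` is positive for `t < 1 / (‖m₀‖_∞ M)`. Since `|R L| ≤ M² / 4`, the flow moves with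
bounded speed and `R - L = 2 u_x` changes along it at rate at most `M³ / 2`; if `m₀ ∂ₓu₀ < 0` at a
point, `w` decreases there initially and, under the criterion, would be negative before `1 / M²`.
The criterion is homogeneous in `m₀`, which gives the statement for `ε m₀`.
-/

open scoped NNReal BoundedContinuousFunction

namespace MCH

/-! ### Functions of two real variables and parametric primitives -/

/-- A function of two real variables with continuous partial derivatives on an open set is strictly
differentiable there. -/
theorem hasStrictFDerivAt_of_partials {s : Set (ℝ × ℝ)} (hs : IsOpen s) {F Fx Ft : ℝ × ℝ → ℝ}
    (hx : ∀ p ∈ s, HasDerivAt (fun x => F (x, p.2)) (Fx p) p.1)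
    (ht : ∀ p ∈ s, HasDerivAt (fun t => F (p.1, t)) (Ft p) p.2)
    (hFx : ContinuousOn Fx s) (hFt : ContinuousOn Ft s) {p : ℝ × ℝ} (hp : p ∈ s) :
    HasStrictFDerivAt F
      (Fx p • ContinuousLinearMap.fst ℝ ℝ ℝ + Ft p • ContinuousLinearMap.snd ℝ ℝ ℝ) p := by
  have key := hasStrictFDerivAt_uncurry_coprod (𝕜 := ℝ) (u := p) (f := fun x t => F (x, t))
    (f₁ := fun x t => ContinuousLinearMap.toSpanSingleton ℝ (Fx (x, t)))
    (f₂ := fun x t => ContinuousLinearMap.toSpanSingleton ℝ (Ft (x, t)))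
    (by filter_upwards [hs.mem_nhds hp] with v hv using (hx v hv).hasFDerivAt)
    (by filter_upwards [hs.mem_nhds hp] with v hv using (ht v hv).hasFDerivAt)
    ((ContinuousLinearMap.toSpanSingletonCLE (𝕜 := ℝ) (E := ℝ)).continuous.continuousAt.comp
      (hFx.continuousAt (hs.mem_nhds hp)))
    ((ContinuousLinearMap.toSpanSingletonCLE (𝕜 := ℝ) (E := ℝ)).continuous.continuousAt.comp
      (hFt.continuousAt (hs.mem_nhds hp)))
  convert! key using 1
  ext <;> simp [Function.HasUncurry.uncurry]

theorem contDiffOn_succ_of_partials {n : ℕ} {s : Set (ℝ × ℝ)} (hs : IsOpen s)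
    {F Fx Ft : ℝ × ℝ → ℝ}
    (hx : ∀ p ∈ s, HasDerivAt (fun x => F (x, p.2)) (Fx p) p.1)
    (ht : ∀ p ∈ s, HasDerivAt (fun t => F (p.1, t)) (Ft p) p.2)
    (hFx : ContDiffOn ℝ n Fx s) (hFt : ContDiffOn ℝ n Ft s) :
    ContDiffOn ℝ (n + 1) F s := by
  have key : ∀ p ∈ s, HasFDerivAt F
      (Fx p • ContinuousLinearMap.fst ℝ ℝ ℝ + Ft p • ContinuousLinearMap.snd ℝ ℝ ℝ) p :=
    fun p hp => (hasStrictFDerivAt_of_partials hs hx ht hFx.continuousOn hFt.continuousOn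
      hp).hasFDerivAt
  rw [contDiffOn_succ_iff_fderiv_of_isOpen hs]
  refine ⟨fun p hp => (key p hp).differentiableAt.differentiableWithinAt, by simp, ?_⟩
  exact ((hFx.smul contDiffOn_const).add (hFt.smul contDiffOn_const)).congr
    fun p hp => (key p hp).fderiv

/-- Chain rule along a curve `s ↦ (z s, s)`. -/
theorem hasDerivAt_along_curve {s : Set (ℝ × ℝ)} (hs : IsOpen s) {F Fx Ft : ℝ × ℝ → ℝ}
    (hx : ∀ p ∈ s, HasDerivAt (fun x => F (x, p.2)) (Fx p) p.1)
    (ht : ∀ p ∈ s, HasDerivAt (fun t => F (p.1, t)) (Ft p) p.2)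
    (hFx : ContinuousOn Fx s) (hFt : ContinuousOn Ft s)
    {z : ℝ → ℝ} {z' t : ℝ} (hz : HasDerivAt z z' t) (hp : (z t, t) ∈ s) :
    HasDerivAt (fun r => F (z r, r)) (Ft (z t, t) + z' * Fx (z t, t)) t := by
  have h : HasFDerivAt F _ ((fun r => (z r, r)) t) :=
    (hasStrictFDerivAt_of_partials hs hx ht hFx hFt hp).hasFDerivAt
  have h2 : HasDerivAt (fun r => (z r, r)) (z', (1 : ℝ)) t := hz.prodMk (hasDerivAt_id t)
  refine (h.comp_hasDerivAt (f := fun r => (z r, r)) t h2).congr_deriv ?_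
  simp
  ring

theorem continuousOn_parametric_primitive {I J : Set ℝ} (hJ : IsOpen J) (hJc : J.OrdConnected)
    (h0 : (0 : ℝ) ∈ J) {f : ℝ × ℝ → ℝ} (hf : ContinuousOn f (I ×ˢ J)) :
    ContinuousOn (fun p : ℝ × ℝ => ∫ s in (0 : ℝ)..p.2, f (p.1, s)) (I ×ˢ J) := by
  rintro ⟨x₀, t₀⟩ ⟨hx₀, ht₀⟩
  -- Clamping the integration variable to a compact interval makes the integrand continuous.
  obtain ⟨a, b, h0ab, habn, hab⟩ : ∃ a b : ℝ, 0 ∈ Icc a b ∧ Icc a b ∈ 𝓝 t₀ ∧ Icc a b ⊆ J := by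
    obtain ⟨r, hr, hball⟩ := Metric.nhds_basis_closedBall.mem_iff.1 (hJ.mem_nhds ht₀)
    rw [Real.closedBall_eq_Icc] at hball
    have h1 : t₀ - r ∈ J := hball ⟨le_rfl, by linarith⟩
    have h2 : t₀ + r ∈ J := hball ⟨by linarith, le_rfl⟩
    refine ⟨min 0 (t₀ - r), max 0 (t₀ + r), ⟨min_le_left _ _, le_max_left _ _⟩, ?_, ?_⟩
    · exact Icc_mem_nhds (min_lt_iff.2 (Or.inr (by linarith))) (lt_max_iff.2 (Or.inr (by linarith)))
    · refine hJc.out ?_ ?_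
      · rcases min_choice 0 (t₀ - r) with h | h <;> rw [h] <;> assumption
      · rcases max_choice 0 (t₀ + r) with h | h <;> rw [h] <;> assumption
  have hle : a ≤ b := h0ab.1.trans h0ab.2
  let g : I → ℝ → ℝ := fun x s => f (x, projIcc a b hle s)
  have hg : Continuous g.uncurry := by
    refine hf.comp_continuous (f := fun q : I × ℝ => ((q.1 : ℝ), (projIcc a b hle q.2 : ℝ))) ?_ ?_
    · exact (continuous_subtype_val.comp continuous_fst).prodMk
        (continuous_subtype_val.comp (continuous_projIcc.comp continuous_snd))
    · exact fun q => ⟨q.1.2, hab (projIcc a b hle q.2).2⟩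
  have hG := intervalIntegral.continuous_parametric_primitive_of_continuous (μ := volume)
    (a₀ := 0) hg
  have hG' : ContinuousOn (fun p : ℝ × ℝ => ∫ s in (0 : ℝ)..p.2, f (p.1, projIcc a b hle s))
      (I ×ˢ univ) := by
    rw [continuousOn_iff_continuous_domRestrict]
    exact hG.comp (f := fun p : (I ×ˢ (univ : Set ℝ) : Set (ℝ × ℝ)) =>
      ((⟨p.1.1, p.2.1⟩ : I), p.1.2)) (by fun_prop)
  refine ((hG' (x₀, t₀) ⟨hx₀, mem_univ _⟩).mono (prod_mono_right (subset_univ J))).congr_of_eventuallyEq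
    ?_ ?_
  · have : ∀ᶠ p in 𝓝 (x₀, t₀), p.2 ∈ Icc a b := continuous_snd.continuousAt habn
    filter_upwards [mem_nhdsWithin_of_mem_nhds this] with p hp
    refine intervalIntegral.integral_congr fun s hs => ?_
    have : s ∈ Icc a b := ordConnected_Icc.uIcc_subset h0ab hp hs
    simp [projIcc_of_mem hle this]
  · refine intervalIntegral.integral_congr fun s hs => ?_
    have : s ∈ Icc a b := ordConnected_Icc.uIcc_subset h0ab (mem_of_mem_nhds habn) hs
    simp [projIcc_of_mem hle this]

/-- Differentiation under an interval integral whose integrand has a continuous partial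
derivative. -/
theorem hasDerivAt_parametric_primitive {I J : Set ℝ} (hI : IsOpen I) (hJc : J.OrdConnected)
    (h0 : (0 : ℝ) ∈ J) {f fx : ℝ × ℝ → ℝ} (hf : ContinuousOn f (I ×ˢ J))
    (hd : ∀ p ∈ I ×ˢ J, HasDerivAt (fun x => f (x, p.2)) (fx p) p.1)
    (hfx : ContinuousOn fx (I ×ˢ J)) {p : ℝ × ℝ} (hp : p ∈ I ×ˢ J) :
    HasDerivAt (fun x => ∫ s in (0 : ℝ)..p.2, f (x, s)) (∫ s in (0 : ℝ)..p.2, fx (p.1, s)) p.1 := by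
  obtain ⟨x₀, t⟩ := p
  obtain ⟨r, hr, hball⟩ := Metric.nhds_basis_closedBall.mem_iff.1 (hI.mem_nhds hp.1)
  have hsub : uIcc 0 t ⊆ J := hJc.uIcc_subset h0 hp.2
  have hcont : ∀ {g : ℝ × ℝ → ℝ}, ContinuousOn g (I ×ˢ J) → ∀ x ∈ I,
      ContinuousOn (fun s => g (x, s)) (uIcc 0 t) := fun hg x hx =>
    hg.comp (by fun_prop) fun s hs => ⟨hx, hsub hs⟩
  obtain ⟨C, hC⟩ := ((isCompact_closedBall x₀ r).prod (isCompact_uIcc (a := 0) (b := t)))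
    |>.exists_bound_of_continuousOn (hfx.mono (prod_mono hball hsub))
  refine (intervalIntegral.hasDerivAt_integral_of_dominated_loc_of_deriv_le (bound := fun _ => C)
    (F := fun x s => f (x, s)) (F' := fun x s => fx (x, s)) (Metric.closedBall_mem_nhds x₀ hr)
    ?_ (hcont hf _ hp.1).intervalIntegrable ?_ ?_ intervalIntegrable_const ?_).2
  · filter_upwards [hI.mem_nhds hp.1] with x hx
    exact ((hcont hf x hx).mono uIoc_subset_uIcc).aestronglyMeasurable measurableSet_uIoc
  · exact ((hcont hfx _ hp.1).mono uIoc_subset_uIcc).aestronglyMeasurable measurableSet_uIoc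
  · exact ae_of_all _ fun s hs x hx => hC (x, s) ⟨hx, uIoc_subset_uIcc hs⟩
  · exact ae_of_all _ fun s hs x hx => hd (x, s) ⟨hball hx, hsub (uIoc_subset_uIcc hs)⟩

theorem hasDerivAt_primitive {J : Set ℝ} (hJ : IsOpen J) (hJc : J.OrdConnected)
    (h0 : (0 : ℝ) ∈ J) {g : ℝ → ℝ} (hg : ContinuousOn g J) {t : ℝ} (ht : t ∈ J) :
    HasDerivAt (fun t => ∫ s in (0 : ℝ)..t, g s) (g t) t := by
  refine intervalIntegral.integral_hasDerivAt_right
    (hg.mono (hJc.uIcc_subset h0 ht)).intervalIntegrable ?_ (hg.continuousAt (hJ.mem_nhds ht))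
  exact hg.stronglyMeasurableAtFilter hJ t ht

/-- The primitive `∫₀ᵗ f(x, s) ds` of a `C^n` function of two variables is `C^n`. -/
theorem contDiffOn_parametric_primitive {I J : Set ℝ} (hI : IsOpen I) (hJ : IsOpen J)
    (hJc : J.OrdConnected) (h0 : (0 : ℝ) ∈ J) {n : ℕ} {f : ℝ × ℝ → ℝ}
    (hf : ContDiffOn ℝ n f (I ×ˢ J)) :
    ContDiffOn ℝ n (fun p : ℝ × ℝ => ∫ s in (0 : ℝ)..p.2, f (p.1, s)) (I ×ˢ J) := by
  have hIJ := hI.prod hJ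
  induction n generalizing f with
  | zero =>
    rw [Nat.cast_zero, contDiffOn_zero] at hf ⊢
    exact continuousOn_parametric_primitive hJ hJc h0 hf
  | succ n ih =>
    push_cast at hf ⊢
    have hf' := (contDiffOn_succ_iff_fderiv_of_isOpen hIJ).1 hf
    have hfx : ContDiffOn ℝ n (fun p => fderiv ℝ f p (1, 0)) (I ×ˢ J) :=
      hf'.2.2.clm_apply contDiffOn_const
    have hd : ∀ p ∈ I ×ˢ J, HasDerivAt (fun x => f (x, p.2)) (fderiv ℝ f p (1, 0)) p.1 := by
      intro p hp
      have h1 := (hf'.1.differentiableAt (hIJ.mem_nhds hp)).hasFDerivAt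
      exact h1.comp_hasDerivAt p.1 ((hasDerivAt_id p.1).prodMk (hasDerivAt_const p.1 p.2))
    refine contDiffOn_succ_of_partials hIJ (fun p hp => hasDerivAt_parametric_primitive hI hJc h0
      hf.continuousOn hd hfx.continuousOn hp) (Ft := f) (fun p hp => ?_) (ih hfx)
      (hf.of_le (by norm_cast; omega))
    exact hasDerivAt_primitive hJ hJc h0 (hf.continuousOn.comp (f := fun s => (p.1, s))
      (by fun_prop) fun s hs => ⟨hp.1, hs⟩) hp.2

/-! ### One-sided exponential tails -/

/-- The right exponential tail `∫_{θ > ξ} e^{A(ξ) - A(θ)} g(θ) dθ`. For `A = id` it is `u + u_x`,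
where `u = G * g`; for `A` the Lagrangian flow map it is the same quantity along the flow. -/
noncomputable def tailR (A g : ℝ → ℝ) (ξ : ℝ) : ℝ :=
  ∫ θ in Ioi ξ, Real.exp (A ξ - A θ) * g θ

/-- The left exponential tail `∫_{θ ≤ ξ} e^{A(θ) - A(ξ)} g(θ) dθ`. For `A = id` it is `u - u_x`,
where `u = G * g`. -/
noncomputable def tailL (A g : ℝ → ℝ) (ξ : ℝ) : ℝ :=
  ∫ θ in Iic ξ, Real.exp (A θ - A ξ) * g θ

/-- Reflection exchanges the two tails. -/
theorem tailL_eq_tailR (A g : ℝ → ℝ) (ξ : ℝ) :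
    tailL A g ξ = tailR (fun x => -A (-x)) (fun x => g (-x)) (-ξ) := by
  unfold tailL tailR
  rw [← integral_comp_neg_Iic]
  refine setIntegral_congr_fun measurableSet_Iic fun θ _ => ?_
  simp only [neg_neg]
  congr 2
  ring

theorem tailR_eq_mul (A g : ℝ → ℝ) (ξ : ℝ) :
    tailR A g ξ = Real.exp (A ξ) * ∫ θ in Ioi ξ, Real.exp (-A θ) * g θ := by
  unfold tailR
  rw [← integral_const_mul]
  refine setIntegral_congr_fun measurableSet_Ioi fun θ _ => ?_
  simp only [← mul_assoc, ← Real.exp_add, sub_eq_add_neg]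

theorem setIntegral_Ioi_eq_sub {h : ℝ → ℝ} (hh : ∀ a, IntegrableOn h (Ioi a)) (ξ : ℝ) :
    ∫ θ in Ioi ξ, h θ = (∫ θ in Ioi 0, h θ) - ∫ θ in (0 : ℝ)..ξ, h θ := by
  rw [← intervalIntegral.integral_Ioi_sub_Ioi' (hh 0) (hh ξ)]
  ring

theorem hasDerivAt_tailR {A g : ℝ → ℝ} (hA : Continuous A) (hg : Continuous g)
    (hint : ∀ a, IntegrableOn (fun θ => Real.exp (-A θ) * g θ) (Ioi a)) {ξ a' : ℝ}
    (hA' : HasDerivAt A a' ξ) :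
    HasDerivAt (tailR A g) (a' * tailR A g ξ - g ξ) ξ := by
  have hc : Continuous fun θ => Real.exp (-A θ) * g θ := by fun_prop
  have heq : tailR A g = fun x => Real.exp (A x) *
      ((∫ θ in Ioi 0, Real.exp (-A θ) * g θ) - ∫ θ in (0 : ℝ)..x, Real.exp (-A θ) * g θ) := by
    ext x
    rw [tailR_eq_mul, setIntegral_Ioi_eq_sub hint]
  have h := hA'.exp.mul ((intervalIntegral.integral_hasDerivAt_right (hc.intervalIntegrable 0 ξ)
    (hc.stronglyMeasurableAtFilter _ _) hc.continuousAt).const_sub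
      (∫ θ in Ioi 0, Real.exp (-A θ) * g θ))
  rw [heq]
  refine h.congr_deriv ?_
  have : Real.exp (A ξ) * Real.exp (-A ξ) = 1 := by rw [← Real.exp_add]; simp
  linear_combination (-g ξ) * this

theorem hasDerivAt_tailL {A g : ℝ → ℝ} (hA : Continuous A) (hg : Continuous g)
    (hint : ∀ a, IntegrableOn (fun θ => Real.exp (A θ) * g θ) (Iic a)) {ξ a' : ℝ}
    (hA' : HasDerivAt A a' ξ) :
    HasDerivAt (tailL A g) (-a' * tailL A g ξ + g ξ) ξ := by
  have heq : tailL A g = fun ξ => tailR (fun x => -A (-x)) (fun x => g (-x)) (-ξ) :=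
    funext fun ξ => tailL_eq_tailR A g ξ
  have hA2 : HasDerivAt (fun x => -A (-x)) a' (-ξ) := by
    have h1 : HasDerivAt A a' (- -ξ) := by rwa [neg_neg]
    have := (h1.scomp (-ξ) (hasDerivAt_neg (-ξ))).neg
    simpa [Function.comp_def] using! this
  have h := hasDerivAt_tailR (A := fun x => -A (-x)) (g := fun x => g (-x)) (by fun_prop)
    (by fun_prop) (fun a => by
      have := (hint (-a)).comp_neg
      simpa using this.mono_set (by intro x hx; simp at hx ⊢; linarith)) hA2
  rw [heq]
  have h2 := h.scomp ξ (hasDerivAt_neg ξ)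
  refine h2.congr_deriv ?_
  simp
  ring

theorem abs_tailR_le {A g : ℝ → ℝ} (hA : Monotone A) (hg : Integrable g) (ξ : ℝ) :
    |tailR A g ξ| ≤ ∫ θ in Ioi ξ, |g θ| := by
  refine norm_integral_le_of_norm_le (f := fun θ => Real.exp (A ξ - A θ) * g θ)
    hg.abs.integrableOn ?_
  filter_upwards [ae_restrict_mem measurableSet_Ioi] with θ hθ
  rw [norm_mul, Real.norm_eq_abs, Real.norm_eq_abs, Real.abs_exp]
  exact mul_le_of_le_one_left (abs_nonneg _)
    (Real.exp_le_one_iff.2 (sub_nonpos.2 (hA (le_of_lt hθ))))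

theorem abs_tailL_le {A g : ℝ → ℝ} (hA : Monotone A) (hg : Integrable g) (ξ : ℝ) :
    |tailL A g ξ| ≤ ∫ θ in Iic ξ, |g θ| := by
  refine norm_integral_le_of_norm_le (f := fun θ => Real.exp (A θ - A ξ) * g θ)
    hg.abs.integrableOn ?_
  filter_upwards [ae_restrict_mem measurableSet_Iic] with θ hθ
  rw [norm_mul, Real.norm_eq_abs, Real.norm_eq_abs, Real.abs_exp]
  exact mul_le_of_le_one_left (abs_nonneg _)
    (Real.exp_le_one_iff.2 (sub_nonpos.2 (hA hθ)))

theorem abs_tails_add_le {A g : ℝ → ℝ} (hA : Monotone A) (hg : Integrable g) (ξ : ℝ) :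
    |tailR A g ξ| + |tailL A g ξ| ≤ ∫ θ, |g θ| := by
  have h := intervalIntegral.integral_Iic_add_Ioi (b := ξ) hg.abs.integrableOn hg.abs.integrableOn
  linarith [abs_tailR_le hA hg ξ, abs_tailL_le hA hg ξ]

theorem abs_exp_neg_sub_exp_neg_le {a b : ℝ} (ha : 0 ≤ a) (hb : 0 ≤ b) :
    |Real.exp (-a) - Real.exp (-b)| ≤ |a - b| := by
  wlog h : a ≤ b generalizing a b
  · rw [abs_sub_comm, abs_sub_comm a]
    exact this hb ha (le_of_not_ge h)
  have h1 : Real.exp (-b) ≤ Real.exp (-a) := Real.exp_le_exp.2 (by linarith)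
  rw [abs_of_nonneg (by linarith), abs_of_nonpos (by linarith)]
  have h2 : Real.exp (-b) = Real.exp (-a) * Real.exp (a - b) := by rw [← Real.exp_add]; ring_nf
  have h3 := Real.add_one_le_exp (a - b)
  have h4 : Real.exp (-a) ≤ 1 := Real.exp_le_one_iff.2 (by linarith)
  have h5 := Real.exp_pos (-a)
  rw [h2]
  nlinarith

theorem integrableOn_tailR_integrand {A g : ℝ → ℝ} (hA : Monotone A) (hAm : Continuous A)
    (hg : Integrable g) (ξ : ℝ) :
    IntegrableOn (fun θ => Real.exp (A ξ - A θ) * g θ) (Ioi ξ) := by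
  refine Integrable.mono' hg.abs.integrableOn ?_ ?_
  · exact (Continuous.aestronglyMeasurable (by fun_prop)).mul hg.aestronglyMeasurable.restrict
  filter_upwards [ae_restrict_mem measurableSet_Ioi] with θ hθ
  rw [norm_mul, Real.norm_eq_abs, Real.norm_eq_abs, Real.abs_exp]
  exact mul_le_of_le_one_left (abs_nonneg _)
    (Real.exp_le_one_iff.2 (sub_nonpos.2 (hA (le_of_lt hθ))))

/-- The right tail is Lipschitz in the increments of the exponent. -/
theorem abs_tailR_sub_le {A B g : ℝ → ℝ} (hA : Monotone A) (hAc : Continuous A) (hB : Monotone B)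
    (hBc : Continuous B) (hg : Integrable g) {ξ δ : ℝ}
    (h : ∀ θ, ξ < θ → g θ ≠ 0 → |(A θ - A ξ) - (B θ - B ξ)| ≤ δ) :
    |tailR A g ξ - tailR B g ξ| ≤ δ * ∫ θ in Ioi ξ, |g θ| := by
  unfold tailR
  rw [← integral_sub (integrableOn_tailR_integrand hA hAc hg ξ)
    (integrableOn_tailR_integrand hB hBc hg ξ), ← integral_const_mul]
  refine norm_integral_le_of_norm_le
    (f := fun θ => Real.exp (A ξ - A θ) * g θ - Real.exp (B ξ - B θ) * g θ)
    (Integrable.const_mul hg.abs.integrableOn δ) ?_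
  filter_upwards [ae_restrict_mem measurableSet_Ioi] with θ hθ
  rw [← sub_mul, norm_mul, Real.norm_eq_abs, Real.norm_eq_abs]
  by_cases h0 : g θ = 0
  · simp [h0]
  refine mul_le_mul_of_nonneg_right ?_ (abs_nonneg _)
  have := abs_exp_neg_sub_exp_neg_le (sub_nonneg.2 (hA (le_of_lt hθ)))
    (sub_nonneg.2 (hB (le_of_lt hθ)))
  simp only [neg_sub] at this
  exact this.trans (h θ hθ h0)

theorem abs_tailL_sub_le {A B g : ℝ → ℝ} (hA : Monotone A) (hAc : Continuous A) (hB : Monotone B)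
    (hBc : Continuous B) (hg : Integrable g) {ξ δ : ℝ}
    (h : ∀ θ, θ < ξ → g θ ≠ 0 → |(A ξ - A θ) - (B ξ - B θ)| ≤ δ) :
    |tailL A g ξ - tailL B g ξ| ≤ δ * ∫ θ in Iic ξ, |g θ| := by
  have key := abs_tailR_sub_le (A := fun x => -A (-x)) (B := fun x => -B (-x))
    (g := fun x => g (-x)) (ξ := -ξ) (δ := δ)
    (fun x y hxy => neg_le_neg (hA (neg_le_neg hxy))) (by fun_prop)
    (fun x y hxy => neg_le_neg (hB (neg_le_neg hxy))) (by fun_prop) hg.comp_neg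
    (fun θ hθ h0 => by
      have := h (-θ) (by linarith) h0
      convert this using 2
      simp only [neg_neg]
      ring)
  rw [tailL_eq_tailR, tailL_eq_tailR]
  rwa [← integral_comp_neg_Iic ξ (fun x => |g (-x)|), setIntegral_congr_fun (g := fun x => |g x|)
    measurableSet_Iic (fun x _ => by simp)] at key

/-- Difference of the tails for two exponents with uniformly close increments. -/
theorem abs_tails_sub_add_le {A B g : ℝ → ℝ} (hA : Monotone A) (hAc : Continuous A)
    (hB : Monotone B) (hBc : Continuous B) (hg : Integrable g) {ξ δ : ℝ}
    (h : ∀ θ, g θ ≠ 0 → |(A θ - A ξ) - (B θ - B ξ)| ≤ δ) :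
    |tailR A g ξ - tailR B g ξ| + |tailL A g ξ - tailL B g ξ| ≤ δ * ∫ θ, |g θ| := by
  have h1 := abs_tailR_sub_le hA hAc hB hBc hg (ξ := ξ) (δ := δ) fun θ _ h0 => h θ h0
  have h2 := abs_tailL_sub_le hA hAc hB hBc hg (ξ := ξ) (δ := δ) fun θ _ h0 => by
    rw [abs_sub_comm]
    convert h θ h0 using 2
    ring
  rw [← intervalIntegral.integral_Iic_add_Ioi (b := ξ) hg.abs.integrableOn hg.abs.integrableOn]
  linarith

/-! ### Tails of compactly supported functions -/

theorem contDiffOn_tailR {J : Set ℝ} (hJ : IsOpen J) {n : ℕ} {A : ℝ × ℝ → ℝ}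
    (hA : ContDiffOn ℝ n A (univ ×ˢ J)) {g : ℝ → ℝ} (hg : ContDiff ℝ n g)
    (hsupp : HasCompactSupport g) :
    ContDiffOn ℝ n (fun p : ℝ × ℝ => tailR (fun θ => A (θ, p.2)) g p.1) (univ ×ˢ J) := by
  obtain ⟨L, hL⟩ := hsupp.isCompact.isBounded.subset_closedBall 0
  have hg0 : ∀ θ, L < θ → g θ = 0 := fun θ hθ => by
    by_contra h
    have := hL (subset_tsupport g h)
    rw [Real.closedBall_eq_Icc] at this
    linarith [this.2]
  have hf : ContDiffOn ℝ n (fun q : ℝ × ℝ => Real.exp (-A (q.2, q.1)) * g q.2) (J ×ˢ univ) := by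
    refine ContDiffOn.mul ?_ (hg.comp contDiff_snd).contDiffOn
    refine (ContDiffOn.neg ?_).exp
    exact hA.comp (f := fun q : ℝ × ℝ => (q.2, q.1)) (contDiff_snd.prodMk contDiff_fst).contDiffOn
      fun q hq => ⟨mem_univ _, hq.1⟩
  have hP := contDiffOn_parametric_primitive hJ isOpen_univ ordConnected_univ (mem_univ _) hf
  have h1 := hP.comp (f := fun p : ℝ × ℝ => (p.2, p.1)) (s := univ ×ˢ J)
    (contDiff_snd.prodMk contDiff_fst).contDiffOn fun q hq => ⟨hq.2, mem_univ _⟩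
  have h2 := hP.comp (f := fun p : ℝ × ℝ => (p.2, L)) (s := univ ×ˢ J)
    (contDiff_snd.prodMk contDiff_const).contDiffOn fun q hq => ⟨hq.2, mem_univ _⟩
  refine (hA.exp.mul (h2.sub h1)).congr fun p hp => ?_
  have hc : Continuous fun θ => Real.exp (-A (θ, p.2)) * g θ :=
    continuousOn_univ.1 <| hf.continuousOn.comp (f := fun θ => (p.2, θ)) (s := univ) (by fun_prop)
      fun θ _ => ⟨hp.2, mem_univ _⟩
  have hcs : HasCompactSupport fun θ => Real.exp (-A (θ, p.2)) * g θ := hsupp.mul_left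
  have hi : Integrable (fun θ => Real.exp (-A (θ, p.2)) * g θ) volume :=
    hc.integrable_of_hasCompactSupport hcs
  rw [tailR_eq_mul, setIntegral_Ioi_eq_sub fun a => hi.integrableOn]
  congr 2
  simp only [Function.comp_apply]
  rw [← intervalIntegral.integral_Ioi_sub_Ioi' (b := L) hi.integrableOn hi.integrableOn,
    setIntegral_eq_zero_of_forall_eq_zero (t := Ioi L) fun θ hθ => by simp [hg0 θ hθ], sub_zero]

theorem contDiffOn_tailL {J : Set ℝ} (hJ : IsOpen J) {n : ℕ} {A : ℝ × ℝ → ℝ}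
    (hA : ContDiffOn ℝ n A (univ ×ˢ J)) {g : ℝ → ℝ} (hg : ContDiff ℝ n g)
    (hsupp : HasCompactSupport g) :
    ContDiffOn ℝ n (fun p : ℝ × ℝ => tailL (fun θ => A (θ, p.2)) g p.1) (univ ×ˢ J) := by
  have hr : ∀ s : Set ℝ, ContDiffOn ℝ n (fun q : ℝ × ℝ => (-q.1, q.2)) (univ ×ˢ s) := fun s =>
    (contDiff_fst.neg.prodMk contDiff_snd).contDiffOn
  have h := contDiffOn_tailR hJ (A := fun q => -A (-q.1, q.2)) (g := fun x => g (-x))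
    (hA.comp (hr J) fun q hq => ⟨mem_univ _, hq.2⟩).neg (hg.comp contDiff_neg)
    (hsupp.comp_homeomorph (Homeomorph.neg ℝ))
  refine (h.comp (hr J) fun q hq => ⟨mem_univ _, hq.2⟩).congr fun p _ => ?_
  rw [tailL_eq_tailR]
  rfl

/-! ### The operator `G *` on bounded continuous functions -/

section Bounded

variable {g : ℝ → ℝ} {C : ℝ}

theorem integrableOn_exp_neg_mul (hg : Continuous g) (hC : ∀ x, |g x| ≤ C) (a : ℝ) :
    IntegrableOn (fun θ => Real.exp (-θ) * g θ) (Ioi a) := by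
  refine Integrable.mono' ((integrableOn_exp_neg_Ioi a).mul_const C)
    (Continuous.aestronglyMeasurable (by fun_prop)) (ae_of_all _ fun θ => ?_)
  rw [norm_mul, Real.norm_eq_abs, Real.norm_eq_abs, Real.abs_exp]
  exact mul_le_mul_of_nonneg_left (hC θ) (Real.exp_pos _).le

theorem integrableOn_exp_mul (hg : Continuous g) (hC : ∀ x, |g x| ≤ C) (a : ℝ) :
    IntegrableOn (fun θ => Real.exp θ * g θ) (Iic a) := by
  refine Integrable.mono' ((integrableOn_exp_Iic a).mul_const C)
    (Continuous.aestronglyMeasurable (by fun_prop)) (ae_of_all _ fun θ => ?_)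
  rw [norm_mul, Real.norm_eq_abs, Real.norm_eq_abs, Real.abs_exp]
  exact mul_le_mul_of_nonneg_left (hC θ) (Real.exp_pos _).le

theorem abs_tailR_id_le (hC : ∀ x, |g x| ≤ C) (x : ℝ) : |tailR id g x| ≤ C := by
  rw [tailR_eq_mul, abs_mul, Real.abs_exp]
  have h : |∫ θ in Ioi x, Real.exp (-id θ) * g θ| ≤ ∫ θ in Ioi x, Real.exp (-θ) * C := by
    refine norm_integral_le_of_norm_le (f := fun θ => Real.exp (-id θ) * g θ)
      ((integrableOn_exp_neg_Ioi x).mul_const C) (ae_of_all _ fun θ => ?_)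
    rw [norm_mul, Real.norm_eq_abs, Real.norm_eq_abs, Real.abs_exp]
    exact mul_le_mul_of_nonneg_left (hC θ) (Real.exp_pos _).le
  rw [integral_mul_const, integral_exp_neg_Ioi] at h
  calc Real.exp (id x) * _ ≤ Real.exp x * (Real.exp (-x) * C) :=
        mul_le_mul_of_nonneg_left h (Real.exp_pos _).le
    _ = C := by rw [← mul_assoc, ← Real.exp_add]; simp

theorem tailL_id_eq_tailR_id (g : ℝ → ℝ) (x : ℝ) :
    tailL id g x = tailR id (fun y => g (-y)) (-x) := by
  rw [tailL_eq_tailR]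
  congr 1
  ext y
  simp

theorem abs_tailL_id_le (hC : ∀ x, |g x| ≤ C) (x : ℝ) : |tailL id g x| ≤ C := by
  rw [tailL_id_eq_tailR_id]
  exact abs_tailR_id_le (fun y => hC (-y)) (-x)

theorem hasDerivAt_tailR_id (hg : Continuous g) (hC : ∀ x, |g x| ≤ C) (x : ℝ) :
    HasDerivAt (tailR id g) (tailR id g x - g x) x := by
  simpa using hasDerivAt_tailR continuous_id hg (integrableOn_exp_neg_mul hg hC) (hasDerivAt_id x)

theorem hasDerivAt_tailL_id (hg : Continuous g) (hC : ∀ x, |g x| ≤ C) (x : ℝ) :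
    HasDerivAt (tailL id g) (-tailL id g x + g x) x := by
  simpa using hasDerivAt_tailL continuous_id hg (integrableOn_exp_mul hg hC) (hasDerivAt_id x)

theorem tailR_id_sub {h : ℝ → ℝ} {D : ℝ} (hg : Continuous g) (hC : ∀ x, |g x| ≤ C)
    (hh : Continuous h) (hD : ∀ x, |h x| ≤ D) (x : ℝ) :
    tailR id g x - tailR id h x = tailR id (fun y => g y - h y) x := by
  simp only [tailR_eq_mul, id]
  rw [← mul_sub, ← integral_sub (integrableOn_exp_neg_mul hg hC x)
    (integrableOn_exp_neg_mul hh hD x)]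
  simp only [mul_sub]

theorem tailL_id_sub {h : ℝ → ℝ} {D : ℝ} (hg : Continuous g) (hC : ∀ x, |g x| ≤ C)
    (hh : Continuous h) (hD : ∀ x, |h x| ≤ D) (x : ℝ) :
    tailL id g x - tailL id h x = tailL id (fun y => g y - h y) x := by
  simp only [tailL_id_eq_tailR_id]
  exact tailR_id_sub (hg.comp continuous_neg) (fun y => hC (-y)) (hh.comp continuous_neg)
    (fun y => hD (-y)) (-x)

theorem helmholtzInv_eq (hg : Continuous g) (hC : ∀ x, |g x| ≤ C) (x : ℝ) :
    helmholtzInv g x = (tailR id g x + tailL id g x) / 2 := by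
  have hR : ∀ θ ∈ Ioi x, G (x - θ) * g θ = 1 / 2 * (Real.exp (id x - id θ) * g θ) := by
    intro θ hθ
    rw [G, abs_of_nonpos (sub_nonpos.2 (le_of_lt hθ)), neg_neg, mul_assoc]
    rfl
  have hL : ∀ θ ∈ Iic x, G (x - θ) * g θ = 1 / 2 * (Real.exp (id θ - id x) * g θ) := by
    intro θ hθ
    rw [G, abs_of_nonneg (sub_nonneg.2 hθ), neg_sub, mul_assoc]
    rfl
  have hiR : IntegrableOn (fun θ => G (x - θ) * g θ) (Ioi x) := by
    refine (integrableOn_congr_fun hR measurableSet_Ioi).2 (Integrable.const_mul ?_ _)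
    have := (integrableOn_exp_neg_mul hg hC x).const_mul (Real.exp x)
    refine this.congr (ae_of_all _ fun θ => ?_)
    simp only [← mul_assoc, ← Real.exp_add, sub_eq_add_neg, id]
  have hiL : IntegrableOn (fun θ => G (x - θ) * g θ) (Iic x) := by
    refine (integrableOn_congr_fun hL measurableSet_Iic).2 (Integrable.const_mul ?_ _)
    have := (integrableOn_exp_mul hg hC x).const_mul (Real.exp (-x))
    refine this.congr (ae_of_all _ fun θ => ?_)
    simp only [← mul_assoc, ← Real.exp_add, sub_eq_add_neg, id, add_comm]
  rw [helmholtzInv, ← intervalIntegral.integral_Iic_add_Ioi hiL hiR,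
    setIntegral_congr_fun measurableSet_Ioi hR, setIntegral_congr_fun measurableSet_Iic hL,
    integral_const_mul, integral_const_mul]
  unfold tailR tailL
  ring

theorem hasDerivAt_helmholtzInv (hg : Continuous g) (hC : ∀ x, |g x| ≤ C) (x : ℝ) :
    HasDerivAt (helmholtzInv g) ((tailR id g x - tailL id g x) / 2) x := by
  have h : helmholtzInv g = fun x => (tailR id g x + tailL id g x) / 2 :=
    funext (helmholtzInv_eq hg hC)
  rw [h]
  refine (((hasDerivAt_tailR_id hg hC x).add (hasDerivAt_tailL_id hg hC x)).div_const 2).congr_deriv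
    ?_
  ring

theorem deriv_helmholtzInv (hg : Continuous g) (hC : ∀ x, |g x| ≤ C) (x : ℝ) :
    deriv (helmholtzInv g) x = (tailR id g x - tailL id g x) / 2 :=
  (hasDerivAt_helmholtzInv hg hC x).deriv

/-- The identity `(G * g)'' = G * g - g`. -/
theorem hasDerivAt_deriv_helmholtzInv (hg : Continuous g) (hC : ∀ x, |g x| ≤ C) (x : ℝ) :
    HasDerivAt (deriv (helmholtzInv g)) (helmholtzInv g x - g x) x := by
  have h : deriv (helmholtzInv g) = fun x => (tailR id g x - tailL id g x) / 2 :=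
    funext (deriv_helmholtzInv hg hC)
  rw [h, helmholtzInv_eq hg hC]
  refine (((hasDerivAt_tailR_id hg hC x).sub (hasDerivAt_tailL_id hg hC x)).div_const 2).congr_deriv
    ?_
  ring

end Bounded

/-- Change of variables in the tails along an increasing bijection `X` with derivative `w`: if
`(h ∘ X) w = g`, the tails of `h` at `X ξ` are the tails of `g` at `ξ` with exponent `X`. -/
theorem tails_comp {X w g h : ℝ → ℝ} (hX : ∀ ξ, HasDerivAt X (w ξ) ξ) (hw : ∀ ξ, 0 < w ξ)
    (hsurj : Function.Surjective X) (hh : ∀ ξ, h (X ξ) * w ξ = g ξ) (ξ : ℝ) :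
    tailR id h (X ξ) = tailR X g ξ ∧ tailL id h (X ξ) = tailL X g ξ := by
  have hmono : StrictMono X := strictMono_of_deriv_pos fun x => by rw [(hX x).deriv]; exact hw x
  have hR : X '' Ioi ξ = Ioi (X ξ) := by
    ext y
    constructor
    · rintro ⟨θ, hθ, rfl⟩
      exact hmono hθ
    · intro hy
      obtain ⟨θ, rfl⟩ := hsurj y
      exact ⟨θ, hmono.lt_iff_lt.1 hy, rfl⟩
  have hL : X '' Iic ξ = Iic (X ξ) := by
    ext y
    constructor
    · rintro ⟨θ, hθ, rfl⟩
      exact hmono.monotone hθ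
    · intro hy
      obtain ⟨θ, rfl⟩ := hsurj y
      exact ⟨θ, hmono.le_iff_le.1 hy, rfl⟩
  constructor
  · rw [tailR, ← hR, integral_image_eq_integral_abs_deriv_smul measurableSet_Ioi
      (fun x _ => (hX x).hasDerivWithinAt) hmono.injective.injOn, tailR]
    refine setIntegral_congr_fun measurableSet_Ioi fun θ _ => ?_
    simp only [smul_eq_mul, abs_of_pos (hw θ), id, ← hh θ]
    ring
  · rw [tailL, ← hL, integral_image_eq_integral_abs_deriv_smul measurableSet_Iic
      (fun x _ => (hX x).hasDerivWithinAt) hmono.injective.injOn, tailL]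
    refine setIntegral_congr_fun measurableSet_Iic fun θ _ => ?_
    simp only [smul_eq_mul, abs_of_pos (hw θ), id, ← hh θ]
    ring

/-! ### The Lagrangian equation for the stretch of the flow map -/

/-- An autonomous ordinary differential equation with bounded Lipschitz right-hand side in a Banach
space has a global solution. -/
theorem exists_global_solution {E : Type*} [NormedAddCommGroup E] [NormedSpace ℝ E]
    [CompleteSpace E] {F : E → E} {K B : ℝ≥0} (hF : LipschitzWith K F) (hB : ∀ x, ‖F x‖ ≤ B)
    (x₀ : E) : ∃ w : ℝ → E, w 0 = x₀ ∧ ∀ t, HasDerivAt w (F (w t)) t := by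
  have hex : ∀ n : ℕ, ∃ α : ℝ → E, α 0 = x₀ ∧
      ∀ t ∈ Ioo (-((n : ℝ) + 1)) (n + 1), HasDerivAt α (F (α t)) t := by
    intro n
    have hn : (0 : ℝ) ∈ Icc (-((n : ℝ) + 1)) (n + 1) := ⟨by linarith [n.cast_nonneg (α := ℝ)],
      by positivity⟩
    have hP : IsPicardLindelof (fun _ => F) (⟨0, hn⟩ : Icc (-((n : ℝ) + 1)) (n + 1)) x₀
        (B * (n + 1)) 0 B K :=
      IsPicardLindelof.of_time_independent (fun x _ => hB x) (hF.lipschitzOnWith) (by simp)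
    obtain ⟨α, h0, hα⟩ := hP.exists_eq_forall_mem_Icc_hasDerivWithinAt₀
    exact ⟨α, h0, fun t ht => (hα t (Ioo_subset_Icc_self ht)).hasDerivAt (Icc_mem_nhds ht.1 ht.2)⟩
  choose α hα0 hα using hex
  have agree : ∀ n m : ℕ, ∀ t : ℝ, |t| < n + 1 → |t| < m + 1 → α n t = α m t := by
    intro n m
    wlog h : n ≤ m generalizing n m
    · intro t h1 h2
      exact (this m n (le_of_not_ge h) t h2 h1).symm
    intro t h1 _
    have hnm : (n : ℝ) ≤ m := by exact_mod_cast h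
    have hsub : ∀ s ∈ Ioo (-((n : ℝ) + 1)) (n + 1), s ∈ Ioo (-((m : ℝ) + 1)) (m + 1) :=
      fun s hs => ⟨by linarith [hs.1], by linarith [hs.2]⟩
    exact ODE_solution_unique_of_mem_Ioo (v := fun _ => F) (s := fun _ => univ) (t₀ := 0)
      (fun _ _ => hF.lipschitzOnWith)
      ⟨by linarith [n.cast_nonneg (α := ℝ)], by positivity⟩ (fun s hs => ⟨hα n s hs, mem_univ _⟩)
      (fun s hs => ⟨hα m s (hsub s hs), mem_univ _⟩) (by rw [hα0, hα0]) (abs_lt.1 h1)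
  have hceil : ∀ t : ℝ, |t| < (⌈|t|⌉₊ : ℝ) + 1 := fun t => by linarith [Nat.le_ceil |t|]
  refine ⟨fun t => α ⌈|t|⌉₊ t, by simp [hα0], fun t => ?_⟩
  refine (hα _ t (abs_lt.1 (hceil t))).congr_of_eventuallyEq ?_
  filter_upwards [(isOpen_lt continuous_abs continuous_const).mem_nhds (hceil t)] with s hs
  exact agree _ _ s (hceil s) hs

/-- The primitive of `|w|`. As long as the stretch `w` of the flow map is positive, this is the flow
map itself up to an additive constant; the absolute value keeps it monotone for every `w`, which
makes the Lagrangian vector field globally bounded and Lipschitz. -/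
noncomputable def stretchPrimitive (w : ℝ → ℝ) (ξ : ℝ) : ℝ := ∫ θ in (0 : ℝ)..ξ, |w θ|

theorem hasDerivAt_stretchPrimitive {w : ℝ → ℝ} (hw : Continuous w) (ξ : ℝ) :
    HasDerivAt (stretchPrimitive w) |w ξ| ξ :=
  intervalIntegral.integral_hasDerivAt_right (hw.abs.intervalIntegrable _ _)
    (hw.abs.stronglyMeasurableAtFilter _ _) hw.abs.continuousAt

theorem continuous_stretchPrimitive {w : ℝ → ℝ} (hw : Continuous w) :
    Continuous (stretchPrimitive w) :=
  continuous_iff_continuousAt.2 fun ξ => (hasDerivAt_stretchPrimitive hw ξ).continuousAt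

theorem monotone_stretchPrimitive {w : ℝ → ℝ} (hw : Continuous w) :
    Monotone (stretchPrimitive w) :=
  monotone_of_deriv_nonneg (fun ξ => (hasDerivAt_stretchPrimitive hw ξ).differentiableAt)
    fun ξ => by
      rw [(hasDerivAt_stretchPrimitive hw ξ).deriv]
      exact abs_nonneg _

theorem stretchPrimitive_sub {w : ℝ → ℝ} (hw : Continuous w) (a b : ℝ) :
    stretchPrimitive w b - stretchPrimitive w a = ∫ θ in a..b, |w θ| :=
  intervalIntegral.integral_interval_sub_left (hw.abs.intervalIntegrable _ _)
    (hw.abs.intervalIntegrable _ _)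

section Field

variable {m₀ : ℝ → ℝ}

theorem continuous_tailR_stretchPrimitive (hm : Continuous m₀) (hs : HasCompactSupport m₀)
    {w : ℝ → ℝ} (hw : Continuous w) : Continuous (tailR (stretchPrimitive w) m₀) := by
  have hA := continuous_stretchPrimitive hw
  exact continuous_iff_continuousAt.2 fun ξ => (hasDerivAt_tailR hA hm (fun a =>
    (Continuous.integrable_of_hasCompactSupport (by fun_prop) hs.mul_left).integrableOn)
    (hasDerivAt_stretchPrimitive hw ξ)).continuousAt

theorem continuous_tailL_stretchPrimitive (hm : Continuous m₀) (hs : HasCompactSupport m₀)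
    {w : ℝ → ℝ} (hw : Continuous w) : Continuous (tailL (stretchPrimitive w) m₀) := by
  have hA := continuous_stretchPrimitive hw
  exact continuous_iff_continuousAt.2 fun ξ => (hasDerivAt_tailL hA hm (fun a =>
    (Continuous.integrable_of_hasCompactSupport (by fun_prop) hs.mul_left).integrableOn)
    (hasDerivAt_stretchPrimitive hw ξ)).continuousAt

theorem abs_tails_sub_le {A g : ℝ → ℝ} (hA : Monotone A) (hg : Integrable g) (ξ : ℝ) :
    |tailR A g ξ - tailL A g ξ| ≤ ∫ θ, |g θ| :=
  (abs_sub _ _).trans (abs_tails_add_le hA hg ξ)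

/-- The equation `w_t = m₀ (R - L)` for the stretch, with `R`, `L` the tails along the flow, has a
global solution with values in the bounded continuous functions and `w = 1` at time `0`. -/
theorem exists_stretch (hm : Continuous m₀) (hs : HasCompactSupport m₀) :
    ∃ w : ℝ → (ℝ →ᵇ ℝ), Continuous w ∧ (∀ ξ, w 0 ξ = 1) ∧
      ∀ ξ t, HasDerivAt (fun t => w t ξ)
        (m₀ ξ * (tailR (stretchPrimitive (w t)) m₀ ξ - tailL (stretchPrimitive (w t)) m₀ ξ)) t := by
  have hint : Integrable m₀ := hm.integrable_of_hasCompactSupport hs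
  obtain ⟨C, hC⟩ := hs.exists_bound_of_continuous hm
  have hC0 : 0 ≤ C := (norm_nonneg _).trans (hC 0)
  set M := ∫ θ, |m₀ θ|
  have hM0 : 0 ≤ M := integral_nonneg fun _ => abs_nonneg _
  obtain ⟨L, hL⟩ := hs.isCompact.isBounded.subset_closedBall 0
  have hsupp : ∀ θ, m₀ θ ≠ 0 → |θ| ≤ L := fun θ hθ => by
    simpa using hL (subset_tsupport m₀ hθ)
  have hbd : ∀ (w : ℝ →ᵇ ℝ) ξ, ‖m₀ ξ * (tailR (stretchPrimitive w) m₀ ξ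
      - tailL (stretchPrimitive w) m₀ ξ)‖ ≤ C * M := fun w ξ => by
    rw [norm_mul]
    exact mul_le_mul (hC ξ) (abs_tails_sub_le (monotone_stretchPrimitive w.continuous) hint ξ)
      (norm_nonneg _) hC0
  let F : (ℝ →ᵇ ℝ) → (ℝ →ᵇ ℝ) := fun w => BoundedContinuousFunction.ofNormedAddCommGroup
    (fun ξ => m₀ ξ * (tailR (stretchPrimitive w) m₀ ξ - tailL (stretchPrimitive w) m₀ ξ))
    (hm.mul ((continuous_tailR_stretchPrimitive hm hs w.continuous).sub
      (continuous_tailL_stretchPrimitive hm hs w.continuous))) (C * M) (hbd w)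
  have hLip : LipschitzWith (C * (2 * L * M)).toNNReal F := by
    refine LipschitzWith.of_dist_le_mul fun w v => ?_
    rw [BoundedContinuousFunction.dist_le (by positivity)]
    intro ξ
    have hd0 : 0 ≤ dist w v := dist_nonneg
    by_cases h0 : m₀ ξ = 0
    · simp only [F, BoundedContinuousFunction.coe_ofNormedAddCommGroup, h0, zero_mul, dist_self]
      positivity
    have hL0 : 0 ≤ L := (abs_nonneg ξ).trans (hsupp ξ h0)
    have key := abs_tails_sub_add_le (A := stretchPrimitive w) (B := stretchPrimitive v) (g := m₀)
      (monotone_stretchPrimitive w.continuous) (continuous_stretchPrimitive w.continuous)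
      (monotone_stretchPrimitive v.continuous) (continuous_stretchPrimitive v.continuous) hint
      (ξ := ξ) (δ := 2 * L * dist w v) (fun θ hθ => by
        rw [stretchPrimitive_sub w.continuous, stretchPrimitive_sub v.continuous,
          ← intervalIntegral.integral_sub (w.continuous.abs.intervalIntegrable _ _)
          (v.continuous.abs.intervalIntegrable _ _)]
        have h1 := intervalIntegral.norm_integral_le_of_norm_le_const (a := ξ) (b := θ)
          (f := fun θ => |w θ| - |v θ|) (C := dist w v) fun x _ =>
            (abs_abs_sub_abs_le_abs_sub _ _).trans (by
              rw [← Real.dist_eq]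
              exact BoundedContinuousFunction.dist_coe_le_dist x)
        refine h1.trans ?_
        have h2 : |θ - ξ| ≤ 2 * L := by
          have := abs_sub θ ξ
          linarith [hsupp θ hθ, hsupp ξ h0]
        nlinarith)
    simp only [F, BoundedContinuousFunction.coe_ofNormedAddCommGroup]
    rw [Real.dist_eq, ← mul_sub, abs_mul, Real.coe_toNNReal _ (by positivity)]
    calc |m₀ ξ| * _ ≤ C * (2 * L * dist w v * M) := by
          refine mul_le_mul (hC ξ) ?_ (abs_nonneg _) hC0
          refine le_trans ?_ key
          refine le_trans (le_of_eq ?_) (abs_sub _ _)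
          congr 1
          ring
      _ = _ := by ring
  have hB : ∀ w, ‖F w‖ ≤ (C * M).toNNReal := fun w => by
    rw [Real.coe_toNNReal _ (by positivity)]
    exact BoundedContinuousFunction.norm_ofNormedAddCommGroup_le _ (by positivity) (hbd w)
  obtain ⟨w, hw0, hw⟩ := exists_global_solution hLip hB 1
  refine ⟨w, continuous_iff_continuousAt.2 fun t => (hw t).continuousAt, fun ξ => by simp [hw0],
    fun ξ t => ?_⟩
  exact (BoundedContinuousFunction.evalCLM ℝ ξ).hasFDerivAt.comp_hasDerivAt t (hw t)

end Field

/-! ### The Lagrangian flow -/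

/-- The right tail along the flow, `(u + u_x)(X(ξ, t), t)`, as a function of `(ξ, t)`. -/
noncomputable def lagR (m₀ : ℝ → ℝ) (w : ℝ → (ℝ →ᵇ ℝ)) (p : ℝ × ℝ) : ℝ :=
  tailR (stretchPrimitive (w p.2)) m₀ p.1

/-- The left tail along the flow, `(u - u_x)(X(ξ, t), t)`, as a function of `(ξ, t)`. -/
noncomputable def lagL (m₀ : ℝ → ℝ) (w : ℝ → (ℝ →ᵇ ℝ)) (p : ℝ × ℝ) : ℝ :=
  tailL (stretchPrimitive (w p.2)) m₀ p.1

/-- The flow map `X(ξ, t)`, whose velocity `R L` is `u² - u_x²` along the flow. -/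
noncomputable def flow (m₀ : ℝ → ℝ) (w : ℝ → (ℝ →ᵇ ℝ)) (p : ℝ × ℝ) : ℝ :=
  p.1 + ∫ s in (0 : ℝ)..p.2, lagR m₀ w (p.1, s) * lagL m₀ w (p.1, s)

/-- `w` is the global solution of the Lagrangian equation with datum `m₀`. -/
structure IsStretch (m₀ : ℝ → ℝ) (w : ℝ → (ℝ →ᵇ ℝ)) : Prop where
  continuous_datum : Continuous m₀
  compactSupport : HasCompactSupport m₀
  continuous : Continuous w
  init : ∀ ξ, w 0 ξ = 1
  hasDerivAt : ∀ ξ t, HasDerivAt (fun t => w t ξ)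
    (m₀ ξ * (lagR m₀ w (ξ, t) - lagL m₀ w (ξ, t))) t

theorem exists_isStretch {m₀ : ℝ → ℝ} (hm : Continuous m₀) (hs : HasCompactSupport m₀) :
    ∃ w, IsStretch m₀ w := by
  obtain ⟨w, h1, h2, h3⟩ := exists_stretch hm hs
  exact ⟨w, hm, hs, h1, h2, h3⟩

namespace IsStretch

variable {m₀ : ℝ → ℝ} {w : ℝ → (ℝ →ᵇ ℝ)} (h : IsStretch m₀ w)
include h

theorem integrable : Integrable m₀ := h.continuous_datum.integrable_of_hasCompactSupport
  h.compactSupport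

theorem continuous_uncurry : Continuous fun p : ℝ × ℝ => w p.2 p.1 :=
  (h.continuous.comp continuous_snd).eval continuous_fst

theorem continuous_stretchPrimitive_uncurry :
    Continuous fun p : ℝ × ℝ => stretchPrimitive (w p.2) p.1 := by
  have hc := h.continuous_uncurry
  have := intervalIntegral.continuous_parametric_primitive_of_continuous (μ := volume)
    (a₀ := 0) (f := fun (t θ : ℝ) => |w t θ|) (by
      simp only [Function.uncurry_def]
      exact (hc.comp (f := fun q : ℝ × ℝ => (q.2, q.1)) (by fun_prop)).abs)
  exact this.comp (f := fun p : ℝ × ℝ => (p.2, p.1)) (by fun_prop)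

theorem continuous_lagR : Continuous (lagR m₀ w) := by
  have := contDiffOn_tailR (n := 0) isOpen_univ (A := fun p => stretchPrimitive (w p.2) p.1)
    (by
      rw [Nat.cast_zero, contDiffOn_zero]
      exact h.continuous_stretchPrimitive_uncurry.continuousOn)
    (by rw [Nat.cast_zero, contDiff_zero]; exact h.continuous_datum) h.compactSupport
  rw [Nat.cast_zero, contDiffOn_zero, univ_prod_univ, continuousOn_univ] at this
  exact this

theorem continuous_lagL : Continuous (lagL m₀ w) := by
  have := contDiffOn_tailL (n := 0) isOpen_univ (A := fun p => stretchPrimitive (w p.2) p.1)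
    (by
      rw [Nat.cast_zero, contDiffOn_zero]
      exact h.continuous_stretchPrimitive_uncurry.continuousOn)
    (by rw [Nat.cast_zero, contDiff_zero]; exact h.continuous_datum) h.compactSupport
  rw [Nat.cast_zero, contDiffOn_zero, univ_prod_univ, continuousOn_univ] at this
  exact this

theorem hasDerivAt_lagR (p : ℝ × ℝ) : HasDerivAt (fun ξ => lagR m₀ w (ξ, p.2))
    (|w p.2 p.1| * lagR m₀ w p - m₀ p.1) p.1 := by
  have hA := continuous_stretchPrimitive (w p.2).continuous
  have hm := h.continuous_datum
  exact hasDerivAt_tailR hA hm (fun a => (Continuous.integrable_of_hasCompactSupport (by fun_prop)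
    h.compactSupport.mul_left).integrableOn) (hasDerivAt_stretchPrimitive (w p.2).continuous p.1)

theorem hasDerivAt_lagL (p : ℝ × ℝ) : HasDerivAt (fun ξ => lagL m₀ w (ξ, p.2))
    (-|w p.2 p.1| * lagL m₀ w p + m₀ p.1) p.1 := by
  have hA := continuous_stretchPrimitive (w p.2).continuous
  have hm := h.continuous_datum
  exact hasDerivAt_tailL hA hm (fun a => (Continuous.integrable_of_hasCompactSupport (by fun_prop)
    h.compactSupport.mul_left).integrableOn) (hasDerivAt_stretchPrimitive (w p.2).continuous p.1)

theorem abs_add_le (p : ℝ × ℝ) : |lagR m₀ w p| + |lagL m₀ w p| ≤ ∫ θ, |m₀ θ| :=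
  abs_tails_add_le (monotone_stretchPrimitive (w p.2).continuous) h.integrable p.1

theorem abs_sub_le (p : ℝ × ℝ) : |lagR m₀ w p - lagL m₀ w p| ≤ ∫ θ, |m₀ θ| :=
  (abs_sub _ _).trans (h.abs_add_le p)

theorem abs_mul_le (p : ℝ × ℝ) : |lagR m₀ w p * lagL m₀ w p| ≤ (∫ θ, |m₀ θ|) ^ 2 / 4 := by
  have h1 := h.abs_add_le p
  rw [abs_mul]
  nlinarith [abs_nonneg (lagR m₀ w p), abs_nonneg (lagL m₀ w p),
    sq_nonneg (|lagR m₀ w p| - |lagL m₀ w p|)]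

theorem eq_one_add (ξ t : ℝ) :
    w t ξ = 1 + m₀ ξ * ∫ s in (0 : ℝ)..t, (lagR m₀ w (ξ, s) - lagL m₀ w (ξ, s)) := by
  have hR := h.continuous_lagR
  have hL := h.continuous_lagL
  have := intervalIntegral.integral_eq_sub_of_hasDerivAt (a := 0) (b := t)
    (fun s _ => h.hasDerivAt ξ s) (Continuous.intervalIntegrable (by fun_prop) _ _)
  rw [intervalIntegral.integral_const_mul, h.init] at this
  linarith

theorem hasDerivAt_flow_time (p : ℝ × ℝ) : HasDerivAt (fun t => flow m₀ w (p.1, t))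
    (lagR m₀ w p * lagL m₀ w p) p.2 := by
  have hR := h.continuous_lagR
  have hL := h.continuous_lagL
  exact (hasDerivAt_primitive isOpen_univ ordConnected_univ (mem_univ _)
    (g := fun s => lagR m₀ w (p.1, s) * lagL m₀ w (p.1, s)) (by fun_prop) (mem_univ p.2)).const_add _

/-- The space derivative of the flow map is the stretch, because `(R L)_ξ = m₀ (R - L)`. -/
theorem hasDerivAt_flow_space (p : ℝ × ℝ) : HasDerivAt (fun ξ => flow m₀ w (ξ, p.2))
    (w p.2 p.1) p.1 := by
  have hR := h.continuous_lagR
  have hL := h.continuous_lagL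
  have hm := h.continuous_datum
  have key := hasDerivAt_parametric_primitive (p := p) isOpen_univ ordConnected_univ (mem_univ 0)
    (f := fun q => lagR m₀ w q * lagL m₀ w q)
    (fx := fun q => m₀ q.1 * (lagR m₀ w q - lagL m₀ w q)) (by fun_prop) (fun q _ => by
      refine ((h.hasDerivAt_lagR q).mul (h.hasDerivAt_lagL q)).congr_deriv ?_
      ring) (by fun_prop) ⟨mem_univ _, mem_univ _⟩
  refine ((hasDerivAt_id p.1).add key).congr_deriv ?_
  rw [h.eq_one_add p.1 p.2, ← intervalIntegral.integral_const_mul]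

theorem continuous_flow : Continuous (flow m₀ w) := by
  have hR := h.continuous_lagR
  have hL := h.continuous_lagL
  have := contDiffOn_parametric_primitive isOpen_univ isOpen_univ ordConnected_univ (mem_univ 0)
    (n := 0) (f := fun q => lagR m₀ w q * lagL m₀ w q) (by
      rw [Nat.cast_zero, contDiffOn_zero]
      fun_prop)
  rw [Nat.cast_zero, contDiffOn_zero, univ_prod_univ, continuousOn_univ] at this
  exact continuous_fst.add this

theorem abs_flow_sub_le (p : ℝ × ℝ) :
    |flow m₀ w p - p.1| ≤ (∫ θ, |m₀ θ|) ^ 2 / 4 * |p.2| := by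
  have := intervalIntegral.norm_integral_le_of_norm_le_const (a := 0) (b := p.2)
    (f := fun s => lagR m₀ w (p.1, s) * lagL m₀ w (p.1, s)) fun s _ => h.abs_mul_le (p.1, s)
  simpa [flow] using this

theorem surjective_flow (t : ℝ) : Function.Surjective fun ξ => flow m₀ w (ξ, t) := by
  have hc : Continuous fun ξ => flow m₀ w (ξ, t) := h.continuous_flow.comp (by fun_prop)
  have hb := fun ξ => abs_le.1 (h.abs_flow_sub_le (ξ, t))
  refine hc.surjective ?_ ?_
  · refine tendsto_atTop_mono (f := fun ξ => ξ - (∫ θ, |m₀ θ|) ^ 2 / 4 * |t|)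
      (fun ξ => by have := (hb ξ).1; simp only at this; linarith)
      (tendsto_atTop_add_const_right _ _ tendsto_id)
  · refine tendsto_atBot_mono
      (fun ξ => by have := (hb ξ).2; simp only [id] at this ⊢; linarith)
      (tendsto_atBot_add_const_right _ ((∫ θ, |m₀ θ|) ^ 2 / 4 * |t|) tendsto_id)

/-- While the stretch is positive, the exponent in the tails is the flow map. -/
theorem stretchPrimitive_sub_eq {t : ℝ} (hw : ∀ ξ, 0 ≤ w t ξ) (a b : ℝ) :
    stretchPrimitive (w t) b - stretchPrimitive (w t) a = flow m₀ w (b, t) - flow m₀ w (a, t) := by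
  rw [stretchPrimitive_sub (w t).continuous, ← intervalIntegral.integral_eq_sub_of_hasDerivAt
    (f := fun ξ => flow m₀ w (ξ, t)) (fun ξ _ => h.hasDerivAt_flow_space (ξ, t)) ((w t).continuous.intervalIntegrable _ _)]
  exact intervalIntegral.integral_congr fun ξ _ => abs_of_nonneg (hw ξ)

theorem lagR_eq {t : ℝ} (hw : ∀ ξ, 0 ≤ w t ξ) (ξ : ℝ) :
    lagR m₀ w (ξ, t) = tailR (fun ξ => flow m₀ w (ξ, t)) m₀ ξ := by
  refine setIntegral_congr_fun measurableSet_Ioi fun θ _ => ?_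
  simp only [h.stretchPrimitive_sub_eq hw]

theorem lagL_eq {t : ℝ} (hw : ∀ ξ, 0 ≤ w t ξ) (ξ : ℝ) :
    lagL m₀ w (ξ, t) = tailL (fun ξ => flow m₀ w (ξ, t)) m₀ ξ := by
  refine setIntegral_congr_fun measurableSet_Iic fun θ _ => ?_
  simp only [h.stretchPrimitive_sub_eq hw]

theorem eq_one_of_eq_zero {ξ : ℝ} (hξ : m₀ ξ = 0) (t : ℝ) : w t ξ = 1 := by
  rw [h.eq_one_add, hξ, zero_mul, add_zero]

/-! ### Regularity of the flow while the stretch is positive -/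

/-- Positivity of the stretch is an open condition in time: the stretch equals `1` off the compact
support of `m₀`, so a positive stretch is bounded below. -/
theorem isOpen_pos : IsOpen {t | ∀ ξ, 0 < w t ξ} := by
  rw [isOpen_iff_mem_nhds]
  intro t ht
  obtain ⟨c, hc, hcw⟩ : ∃ c, 0 < c ∧ ∀ ξ, c ≤ w t ξ := by
    rcases (tsupport m₀).eq_empty_or_nonempty with he | hne
    · refine ⟨1, one_pos, fun ξ => (h.eq_one_of_eq_zero ?_ t).ge⟩
      exact image_eq_zero_of_notMem_tsupport (by simp [he])
    · obtain ⟨x, _, hx⟩ := h.compactSupport.isCompact.exists_isMinOn hne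
        (w t).continuous.continuousOn
      refine ⟨min 1 (w t x), lt_min one_pos (ht x), fun ξ => ?_⟩
      by_cases hξ : ξ ∈ tsupport m₀
      · exact (min_le_right _ _).trans (hx hξ)
      · rw [h.eq_one_of_eq_zero (image_eq_zero_of_notMem_tsupport hξ)]
        exact min_le_left _ _
  filter_upwards [h.continuous.continuousAt (Metric.ball_mem_nhds (w t) hc)] with s hs ξ
  have h1 := (BoundedContinuousFunction.dist_coe_le_dist (f := w s) (g := w t) ξ).trans_lt hs
  rw [Real.dist_eq] at h1
  linarith [(abs_lt.1 h1).1, hcw ξ]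

/-- As long as the stretch is positive, the stretch, the flow map and the tails are jointly `C^k`:
their derivatives are expressed through primitives of one another, so regularity bootstraps. -/
theorem contDiffOn {k : ℕ} (hm : ContDiff ℝ k m₀) {J : Set ℝ} (hJ : IsOpen J)
    (hJc : J.OrdConnected) (h0 : (0 : ℝ) ∈ J) (hpos : ∀ t ∈ J, ∀ ξ, 0 < w t ξ) :
    ContDiffOn ℝ k (fun p : ℝ × ℝ => w p.2 p.1) (univ ×ˢ J) ∧
    ContDiffOn ℝ k (flow m₀ w) (univ ×ˢ J) ∧
    ContDiffOn ℝ k (lagR m₀ w) (univ ×ˢ J) ∧ ContDiffOn ℝ k (lagL m₀ w) (univ ×ˢ J) := by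
  have hUJ : IsOpen ((univ : Set ℝ) ×ˢ J) := isOpen_univ.prod hJ
  have hR := h.continuous_lagR
  have hL := h.continuous_lagL
  have hw := h.continuous_uncurry
  have hmc := h.continuous_datum
  have hm' : ∀ n ≤ k, ContDiffOn ℝ n (fun p : ℝ × ℝ => m₀ p.1) (univ ×ˢ J) := fun n hn =>
    ((hm.of_le (by exact_mod_cast hn)).comp contDiff_fst).contDiffOn
  -- If the flow map is `C^n`, so are the tails.
  have htails : ∀ n ≤ k, ContDiffOn ℝ n (flow m₀ w) (univ ×ˢ J) →
      ContDiffOn ℝ n (lagR m₀ w) (univ ×ˢ J) ∧ ContDiffOn ℝ n (lagL m₀ w) (univ ×ˢ J) := by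
    intro n hn hX
    have hmn := hm.of_le (m := n) (by exact_mod_cast hn)
    exact ⟨(contDiffOn_tailR hJ hX hmn h.compactSupport).congr
        fun p hp => h.lagR_eq (fun ξ => (hpos p.2 hp.2 ξ).le) p.1,
      (contDiffOn_tailL hJ hX hmn h.compactSupport).congr
        fun p hp => h.lagL_eq (fun ξ => (hpos p.2 hp.2 ξ).le) p.1⟩
  have main : ∀ n ≤ k, ContDiffOn ℝ n (fun p : ℝ × ℝ => w p.2 p.1) (univ ×ˢ J) ∧
      ContDiffOn ℝ n (flow m₀ w) (univ ×ˢ J) := by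
    intro n
    induction n with
    | zero =>
      intro _
      rw [Nat.cast_zero, contDiffOn_zero, contDiffOn_zero]
      exact ⟨hw.continuousOn, h.continuous_flow.continuousOn⟩
    | succ n ih =>
      intro hn
      have hn' : n ≤ k := by omega
      obtain ⟨hwn, hXn⟩ := ih hn'
      obtain ⟨hRn, hLn⟩ := htails n hn' hXn
      push_cast
      constructor
      · have hV : ContDiffOn ℝ (n + 1) (fun p : ℝ × ℝ => ∫ s in (0 : ℝ)..p.2,
            (lagR m₀ w (p.1, s) - lagL m₀ w (p.1, s))) (univ ×ˢ J) := by
          refine contDiffOn_succ_of_partials hUJ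
            (Fx := fun p => ∫ s in (0 : ℝ)..p.2, (fun q : ℝ × ℝ =>
              w q.2 q.1 * (lagR m₀ w q + lagL m₀ w q) - 2 * m₀ q.1) (p.1, s))
            (Ft := fun p => lagR m₀ w p - lagL m₀ w p) (fun p hp => ?_) (fun p hp => ?_)
            (contDiffOn_parametric_primitive isOpen_univ hJ hJc h0
              ((hwn.mul (hRn.add hLn)).sub (contDiffOn_const.mul (hm' n hn')))) (hRn.sub hLn)
          · refine hasDerivAt_parametric_primitive isOpen_univ hJc h0
              (f := fun q => lagR m₀ w q - lagL m₀ w q)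
              (fx := fun q => w q.2 q.1 * (lagR m₀ w q + lagL m₀ w q) - 2 * m₀ q.1)
              (by fun_prop) (fun q hq => ?_)
              ((hw.mul (hR.add hL)).sub
                (continuous_const.mul (hmc.comp continuous_fst))).continuousOn hp
            refine ((h.hasDerivAt_lagR q).sub (h.hasDerivAt_lagL q)).congr_deriv ?_
            rw [abs_of_pos (hpos q.2 hq.2 q.1)]
            ring
          · exact hasDerivAt_primitive hJ hJc h0
              (g := fun s => lagR m₀ w (p.1, s) - lagL m₀ w (p.1, s)) (by fun_prop) hp.2
        have := hm' (n + 1) hn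
        push_cast at this
        exact (contDiffOn_const.add (this.mul hV)).congr fun p _ => h.eq_one_add p.1 p.2
      · exact contDiffOn_succ_of_partials hUJ (fun p _ => h.hasDerivAt_flow_space p)
          (fun p _ => h.hasDerivAt_flow_time p) hwn (hRn.mul hLn)
  obtain ⟨h1, h2⟩ := main k le_rfl
  obtain ⟨h3, h4⟩ := htails k le_rfl h2
  exact ⟨h1, h2, h3, h4⟩

end IsStretch

/-! ### Joint regularity and the classes `C^k_n` -/

theorem timeInterval_top : timeInterval ⊤ = Ici 0 := by
  ext t
  simp [timeInterval]

theorem timeInterval_of_ne_top {T : ℝ≥0∞} (hT : T ≠ ⊤) : timeInterval T = Ico 0 T.toReal := by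
  ext t
  simp only [timeInterval, mem_ofPred_eq, mem_Ico]
  exact and_congr_right fun ht => ENNReal.ofReal_lt_iff_lt_toReal ht hT

theorem uniqueDiffOn_timeInterval (T : ℝ≥0∞) : UniqueDiffOn ℝ (timeInterval T) := by
  rcases eq_or_ne T ⊤ with rfl | hT
  · rw [timeInterval_top]
    exact uniqueDiffOn_Ici 0
  · rw [timeInterval_of_ne_top hT]
    exact uniqueDiffOn_Ico 0 _

theorem Icc_subset_timeInterval {T : ℝ≥0∞} {t : ℝ} (ht : t ∈ timeInterval T) :
    Icc 0 t ⊆ timeInterval T := fun _ hs =>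
  ⟨hs.1, (ENNReal.ofReal_le_ofReal hs.2).trans_lt ht.2⟩

theorem isPreconnected_timeInterval (T : ℝ≥0∞) : IsPreconnected (timeInterval T) := by
  rcases eq_or_ne T ⊤ with rfl | hT
  · rw [timeInterval_top]
    exact isPreconnected_Ici
  · rw [timeInterval_of_ne_top hT]
    exact isPreconnected_Ico

theorem timeInterval_mem_nhds {T : ℝ≥0∞} {t : ℝ} (ht : t ∈ timeInterval T) (h0 : 0 < t) :
    timeInterval T ∈ 𝓝 t := by
  rcases eq_or_ne T ⊤ with rfl | hT
  · rw [timeInterval_top]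
    exact Ici_mem_nhds h0
  · rw [timeInterval_of_ne_top hT] at ht ⊢
    exact Ico_mem_nhds h0 ht.2

section JointRegularity

variable {J : Set ℝ} {F : ℝ × ℝ → ℝ}

theorem hasDerivAt_fst_of_contDiffOn (hJ : IsOpen J) {n : ℕ}
    (hF : ContDiffOn ℝ (n + 1) F (univ ×ˢ J)) {p : ℝ × ℝ} (hp : p.2 ∈ J) :
    HasDerivAt (fun x => F (x, p.2)) (fderiv ℝ F p (1, 0)) p.1 := by
  have h1 := ((hF.differentiableOn (by simp)).differentiableAt
    ((isOpen_univ.prod hJ).mem_nhds (⟨mem_univ _, hp⟩ : p ∈ univ ×ˢ J))).hasFDerivAt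
  exact h1.comp_hasDerivAt p.1 ((hasDerivAt_id p.1).prodMk (hasDerivAt_const p.1 p.2))

theorem hasDerivAt_snd_of_contDiffOn (hJ : IsOpen J) {n : ℕ}
    (hF : ContDiffOn ℝ (n + 1) F (univ ×ˢ J)) {p : ℝ × ℝ} (hp : p.2 ∈ J) :
    HasDerivAt (fun t => F (p.1, t)) (fderiv ℝ F p (0, 1)) p.2 := by
  have h1 := ((hF.differentiableOn (by simp)).differentiableAt
    ((isOpen_univ.prod hJ).mem_nhds (⟨mem_univ _, hp⟩ : p ∈ univ ×ˢ J))).hasFDerivAt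
  exact h1.comp_hasDerivAt p.2 ((hasDerivAt_const p.2 p.1).prodMk (hasDerivAt_id p.2))

theorem contDiffOn_fderiv_apply (hJ : IsOpen J) {n : ℕ}
    (hF : ContDiffOn ℝ (n + 1) F (univ ×ˢ J)) (v : ℝ × ℝ) :
    ContDiffOn ℝ n (fun p => fderiv ℝ F p v) (univ ×ˢ J) :=
  ((contDiffOn_succ_iff_fderiv_of_isOpen (isOpen_univ.prod hJ)).1 hF).2.2.clm_apply contDiffOn_const

theorem contDiffOn_iteratedDeriv_fst (hJ : IsOpen J) (j : ℕ) {n : ℕ}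
    (hF : ContDiffOn ℝ (n + j : ℕ) F (univ ×ˢ J)) :
    ContDiffOn ℝ n (fun p : ℝ × ℝ => iteratedDeriv j (fun x => F (x, p.2)) p.1) (univ ×ˢ J) := by
  induction j generalizing n with
  | zero => simpa using hF
  | succ j ih =>
    have h1 := ih (n := n + 1) (by convert hF using 2; omega)
    push_cast at h1
    refine (contDiffOn_fderiv_apply hJ h1 (1, 0)).congr fun p hp => ?_
    rw [iteratedDeriv_succ]
    exact (hasDerivAt_fst_of_contDiffOn hJ h1 hp.2).deriv

theorem contDiff_slice {n : ℕ} (hF : ContDiffOn ℝ n F (univ ×ˢ J)) {t : ℝ} (ht : t ∈ J) :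
    ContDiff ℝ n fun x => F (x, t) :=
  contDiffOn_univ.1 <| hF.comp (f := fun x => (x, t)) (s := univ)
    (contDiff_id.prodMk contDiff_const).contDiffOn fun _ _ => ⟨mem_univ _, ht⟩

theorem contDiffOn_time_of_contDiffOn {S : Set ℝ} (hS : S ⊆ J) {n : ℕ}
    (hF : ContDiffOn ℝ n F (univ ×ˢ J)) (x : ℝ) : ContDiffOn ℝ n (fun t => F (x, t)) S :=
  hF.comp (f := fun t => (x, t)) (contDiff_const.prodMk contDiff_id).contDiffOn
    fun _ ht => ⟨mem_univ _, hS ht⟩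

theorem continuousOn_iteratedDerivWithin_time (hJ : IsOpen J) {T : ℝ≥0∞} (hT : timeInterval T ⊆ J)
    (hF : ContDiffOn ℝ 1 F (univ ×ˢ J)) {j : ℕ} (hj : j ≤ 1) :
    ContinuousOn (fun p : ℝ × ℝ => iteratedDerivWithin j (fun t => F (p.1, t)) (timeInterval T) p.2)
      (univ ×ˢ timeInterval T) := by
  have hsub : (univ : Set ℝ) ×ˢ timeInterval T ⊆ univ ×ˢ J := prod_mono_right hT
  interval_cases j
  · simpa using hF.continuousOn.mono hsub
  · have hF' : ContDiffOn ℝ ((0 : ℕ) + 1) F (univ ×ˢ J) := by simpa using hF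
    refine ((contDiffOn_fderiv_apply hJ hF' (0, 1)).continuousOn.mono hsub).congr fun p hp => ?_
    rw [iteratedDerivWithin_one]
    exact (hasDerivAt_snd_of_contDiffOn hJ hF' (hT hp.2)).hasDerivWithinAt.derivWithin
      (uniqueDiffOn_timeInterval T _ hp.2)

theorem isClassC_of_contDiffOn (hJ : IsOpen J) {T : ℝ≥0∞} (hT : timeInterval T ⊆ J) {k : ℕ}
    (hk : 1 ≤ k) (hF : ContDiffOn ℝ k F (univ ×ˢ J)) :
    IsClassC k 1 T fun x t => F (x, t) where
  contDiff_space t ht := contDiff_slice hF (hT ht)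
  continuousOn_space j hj := by
    have h := contDiffOn_iteratedDeriv_fst hJ j (n := k - j) (by convert hF; omega)
    exact h.continuousOn.mono (prod_mono_right hT)
  contDiffOn_time x := contDiffOn_time_of_contDiffOn hT
    (hF.of_le (by exact_mod_cast hk)) x
  continuousOn_time j hj := continuousOn_iteratedDerivWithin_time hJ hT
    (hF.of_le (by exact_mod_cast hk)) hj

/-- A jointly `C^k` function `F` with `F_xx = F - m`, `m` jointly `C^k`, gains two derivatives in
space. -/
theorem isClassC_add_two_of_contDiffOn (hJ : IsOpen J) {T : ℝ≥0∞} (hT : timeInterval T ⊆ J) {k : ℕ}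
    (hk : 1 ≤ k) {Fx m : ℝ × ℝ → ℝ} (hF : ContDiffOn ℝ k F (univ ×ˢ J))
    (hFx : ContDiffOn ℝ k Fx (univ ×ˢ J)) (hm : ContDiffOn ℝ k m (univ ×ˢ J))
    (hd : ∀ p : ℝ × ℝ, p.2 ∈ J → HasDerivAt (fun x => F (x, p.2)) (Fx p) p.1)
    (hdd : ∀ p : ℝ × ℝ, p.2 ∈ J → HasDerivAt (fun x => Fx (x, p.2)) (F p - m p) p.1) :
    IsClassC (k + 2) 1 T fun x t => F (x, t) := by
  have e1 : ∀ t ∈ J, deriv (fun x => F (x, t)) = fun x => Fx (x, t) :=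
    fun t ht => funext fun x => (hd (x, t) ht).deriv
  have e2 : ∀ t ∈ J, deriv (fun x => Fx (x, t)) = fun x => F (x, t) - m (x, t) :=
    fun t ht => funext fun x => (hdd (x, t) ht).deriv
  refine ⟨fun t ht => ?_, fun j hj => ?_, contDiffOn_time_of_contDiffOn hT
    (hF.of_le (by exact_mod_cast hk)), fun j hj => continuousOn_iteratedDerivWithin_time hJ hT
    (hF.of_le (by exact_mod_cast hk)) hj⟩
  · have h1 : ContDiff ℝ (k + 1) fun x => Fx (x, t) := by
      rw [contDiff_succ_iff_deriv]
      refine ⟨fun x => (hdd (x, t) (hT ht)).differentiableAt, by simp, ?_⟩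
      rw [e2 t (hT ht)]
      exact (contDiff_slice hF (hT ht)).sub (contDiff_slice hm (hT ht))
    have h2 : ContDiff ℝ (k + 1 + 1) fun x => F (x, t) := by
      rw [contDiff_succ_iff_deriv]
      refine ⟨fun x => (hd (x, t) (hT ht)).differentiableAt, by simp, ?_⟩
      rwa [e1 t (hT ht)]
    convert h2 using 1
    push_cast
    rw [add_assoc]
    norm_num
  · match j with
    | 0 => simpa using hF.continuousOn.mono (prod_mono_right hT)
    | 1 =>
      refine (hFx.continuousOn.mono (prod_mono_right hT)).congr fun p hp => ?_
      rw [iteratedDeriv_one, e1 _ (hT hp.2)]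
    | i + 2 =>
      have h := contDiffOn_iteratedDeriv_fst (F := fun p => F p - m p) hJ i (n := k - i)
        (by convert hF.sub hm; omega)
      refine (h.continuousOn.mono (prod_mono_right hT)).congr fun p hp => ?_
      simp only
      rw [iteratedDeriv_succ', iteratedDeriv_succ', e1 _ (hT hp.2), e2 _ (hT hp.2)]

end JointRegularity

/-! ### The classical solution carried by the flow -/

/-- The Lagrangian label of the point `x` at time `t`: the inverse of the flow map in space. -/
noncomputable def label (m₀ : ℝ → ℝ) (w : ℝ → (ℝ →ᵇ ℝ)) (p : ℝ × ℝ) : ℝ :=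
  Function.invFun (fun ξ => flow m₀ w (ξ, p.2)) p.1

/-- The momentum transported by the flow, `m(X(ξ, t), t) = m₀(ξ) / w(ξ, t)`. -/
noncomputable def solM (m₀ : ℝ → ℝ) (w : ℝ → (ℝ →ᵇ ℝ)) (p : ℝ × ℝ) : ℝ :=
  m₀ (label m₀ w p) / w p.2 (label m₀ w p)

/-- The velocity `u = G * m` of the transported momentum. -/
noncomputable def solU (m₀ : ℝ → ℝ) (w : ℝ → (ℝ →ᵇ ℝ)) (p : ℝ × ℝ) : ℝ :=
  helmholtzInv (fun y => solM m₀ w (y, p.2)) p.1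

namespace IsStretch

variable {m₀ : ℝ → ℝ} {w : ℝ → (ℝ →ᵇ ℝ)} (h : IsStretch m₀ w)
include h

theorem flow_label (p : ℝ × ℝ) : flow m₀ w (label m₀ w p, p.2) = p.1 :=
  Function.rightInverse_invFun (h.surjective_flow p.2) p.1

theorem label_flow {t : ℝ} (ht : ∀ ξ, 0 < w t ξ) (ξ : ℝ) :
    label m₀ w (flow m₀ w (ξ, t), t) = ξ := by
  have hmono : StrictMono fun ξ => flow m₀ w (ξ, t) := strictMono_of_deriv_pos fun x => by
    rw [(h.hasDerivAt_flow_space (x, t)).deriv]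
    exact ht x
  exact Function.leftInverse_invFun hmono.injective ξ

theorem contDiffOn_label {k : ℕ} (hk : 1 ≤ k) (hm : ContDiff ℝ k m₀) {J : Set ℝ} (hJ : IsOpen J)
    (hJc : J.OrdConnected) (h0 : (0 : ℝ) ∈ J) (hpos : ∀ t ∈ J, ∀ ξ, 0 < w t ξ) :
    ContDiffOn ℝ k (label m₀ w) (univ ×ˢ J) := by
  have hUJ : IsOpen ((univ : Set ℝ) ×ˢ J) := isOpen_univ.prod hJ
  obtain ⟨-, hX, -, -⟩ := h.contDiffOn hm hJ hJc h0 hpos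
  rintro ⟨x, t⟩ ⟨-, ht : t ∈ J⟩
  set ξ := label m₀ w (x, t) with hξ
  set a := w t ξ
  have ha : a ≠ 0 := (hpos t ht ξ).ne'
  set v := lagR m₀ w (ξ, t) * lagL m₀ w (ξ, t)
  let Ψ : ℝ × ℝ → ℝ × ℝ := fun q => (flow m₀ w q, q.2)
  have hΨξ : Ψ (ξ, t) = (x, t) := Prod.ext (h.flow_label (x, t)) rfl
  -- The derivative of `(ξ, t) ↦ (X, t)` is triangular with diagonal entries `w` and `1`.
  let e : (ℝ × ℝ) ≃L[ℝ] (ℝ × ℝ) := ContinuousLinearEquiv.equivOfInverse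
    ((a • ContinuousLinearMap.fst ℝ ℝ ℝ + v • ContinuousLinearMap.snd ℝ ℝ ℝ).prod
      (ContinuousLinearMap.snd ℝ ℝ ℝ))
    ((a⁻¹ • ContinuousLinearMap.fst ℝ ℝ ℝ - (a⁻¹ * v) • ContinuousLinearMap.snd ℝ ℝ ℝ).prod
      (ContinuousLinearMap.snd ℝ ℝ ℝ))
    (fun q => by ext <;> simp; field_simp; ring)
    (fun q => by ext <;> simp; field_simp; ring)
  have hR := h.continuous_lagR
  have hL := h.continuous_lagL
  have hd : HasFDerivAt Ψ (e : (ℝ × ℝ) →L[ℝ] (ℝ × ℝ)) (ξ, t) :=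
    (hasStrictFDerivAt_of_partials isOpen_univ (fun p _ => h.hasDerivAt_flow_space p)
      (fun p _ => h.hasDerivAt_flow_time p) h.continuous_uncurry.continuousOn
      (by fun_prop) (mem_univ (ξ, t))).hasFDerivAt.prodMk hasFDerivAt_snd
  have hc : ContDiffAt ℝ k Ψ (ξ, t) :=
    (hX.contDiffAt (hUJ.mem_nhds ⟨mem_univ _, ht⟩)).prodMk contDiffAt_snd
  have hk0 : (k : WithTop ℕ∞) ≠ 0 := by exact_mod_cast (by omega : k ≠ 0)
  have hg := hc.to_localInverse hd hk0
  have hright := (hc.hasStrictFDerivAt' hd hk0).eventually_right_inverse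
  rw [hΨξ] at hg hright
  refine ContDiffAt.contDiffWithinAt ?_
  refine (contDiffAt_fst.comp (x, t) hg).congr_of_eventuallyEq ?_
  filter_upwards [hright, hUJ.mem_nhds (⟨mem_univ _, ht⟩ : (x, t) ∈ univ ×ˢ J)] with y hy hyJ
  set q := (hc.hasStrictFDerivAt' hd hk0).localInverse Ψ e (ξ, t) y
  have h1 : flow m₀ w q = y.1 := (congrArg Prod.fst hy : (Ψ q).1 = y.1)
  have h2 : q.2 = y.2 := (congrArg Prod.snd hy : (Ψ q).2 = y.2)
  have h3 := h.label_flow (hpos y.2 hyJ.2) q.1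
  rw [← h2, Prod.mk.eta, h1, h2, Prod.mk.eta] at h3
  exact h3

theorem solM_flow_mul {t : ℝ} (ht : ∀ ξ, 0 < w t ξ) (ξ : ℝ) :
    solM m₀ w (flow m₀ w (ξ, t), t) * w t ξ = m₀ ξ := by
  rw [solM, h.label_flow ht]
  exact div_mul_cancel₀ _ (ht ξ).ne'

theorem solM_zero (x : ℝ) : solM m₀ w (x, 0) = m₀ x := by
  have := h.solM_flow_mul (t := 0) (fun ξ => by rw [h.init]; exact one_pos) x
  rwa [h.init, mul_one, show flow m₀ w (x, 0) = x by simp [flow]] at this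

/-- The transported momentum is supported in a bounded interval, locally uniformly in time. -/
theorem exists_solM_eq_zero (τ : ℝ) : ∃ r, ∀ t, |t| ≤ τ → ∀ x, r < |x| → solM m₀ w (x, t) = 0 := by
  obtain ⟨L, hL⟩ := h.compactSupport.isCompact.isBounded.subset_closedBall 0
  refine ⟨L + (∫ θ, |m₀ θ|) ^ 2 / 4 * τ, fun t ht x hx => ?_⟩
  rw [solM]
  by_contra hne
  have h1 : m₀ (label m₀ w (x, t)) ≠ 0 := fun h0 => hne (by rw [h0, zero_div])
  have h2 : |label m₀ w (x, t)| ≤ L := by simpa using hL (subset_tsupport m₀ h1)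
  have h3 := h.abs_flow_sub_le (label m₀ w (x, t), t)
  rw [h.flow_label (x, t)] at h3
  simp only at h3
  have h4 : (∫ θ, |m₀ θ|) ^ 2 / 4 * |t| ≤ (∫ θ, |m₀ θ|) ^ 2 / 4 * τ :=
    mul_le_mul_of_nonneg_left ht (by positivity)
  have h5 := abs_sub_abs_le_abs_sub x (label m₀ w (x, t))
  linarith

theorem hasCompactSupport_solM (t : ℝ) : HasCompactSupport fun x => solM m₀ w (x, t) := by
  obtain ⟨r, hr⟩ := h.exists_solM_eq_zero |t|
  refine HasCompactSupport.intro (isCompact_closedBall (0 : ℝ) r) fun x hx => ?_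
  exact hr t le_rfl x (by simpa using hx)

/-! The next statements hold on an open interval `J` of times around `0` on which the stretch is
positive. -/

variable {k : ℕ} (hk : 1 ≤ k) (hm : ContDiff ℝ k m₀) {J : Set ℝ} (hJ : IsOpen J)
  (hJc : J.OrdConnected) (h0 : (0 : ℝ) ∈ J) (hpos : ∀ t ∈ J, ∀ ξ, 0 < w t ξ)
include hk hm hJ hJc h0 hpos

/-- Composition with the inverse of `(ξ, t) ↦ (X(ξ, t), t)` preserves joint regularity. -/
theorem contDiffOn_comp_label {f : ℝ × ℝ → ℝ} (hf : ContDiffOn ℝ k f (univ ×ˢ J)) :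
    ContDiffOn ℝ k (fun p : ℝ × ℝ => f (label m₀ w p, p.2)) (univ ×ˢ J) :=
  hf.comp ((h.contDiffOn_label hk hm hJ hJc h0 hpos).prodMk contDiff_snd.contDiffOn)
    fun _ hp => ⟨mem_univ _, hp.2⟩

theorem contDiffOn_solM : ContDiffOn ℝ k (solM m₀ w) (univ ×ˢ J) := by
  obtain ⟨hw, -, -, -⟩ := h.contDiffOn hm hJ hJc h0 hpos
  exact h.contDiffOn_comp_label hk hm hJ hJc h0 hpos (f := fun p => m₀ p.1 / w p.2 p.1)
    (((hm.comp contDiff_fst).contDiffOn).div hw fun p hp => (hpos p.2 hp.2 p.1).ne')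

theorem continuous_solM {t : ℝ} (ht : t ∈ J) : Continuous fun x => solM m₀ w (x, t) :=
  (contDiff_slice (h.contDiffOn_solM hk hm hJ hJc h0 hpos) ht).continuous

omit hk hm hJ hJc h0 hpos in
theorem tails_solM {t : ℝ} (ht : ∀ ξ, 0 < w t ξ) (x : ℝ) :
    tailR id (fun y => solM m₀ w (y, t)) x = lagR m₀ w (label m₀ w (x, t), t) ∧
    tailL id (fun y => solM m₀ w (y, t)) x = lagL m₀ w (label m₀ w (x, t), t) := by
  have := tails_comp (h := fun y => solM m₀ w (y, t)) (fun ξ => h.hasDerivAt_flow_space (ξ, t)) ht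
    (h.surjective_flow t) (h.solM_flow_mul ht) (label m₀ w (x, t))
  rw [h.flow_label (x, t)] at this
  rwa [h.lagR_eq (fun ξ => (ht ξ).le), h.lagL_eq (fun ξ => (ht ξ).le)]

theorem exists_bound_solM {τ : ℝ} (hτ : Icc 0 τ ⊆ J) :
    ∃ C, ∀ t ∈ Icc 0 τ, ∀ x, |solM m₀ w (x, t)| ≤ C ∧
      |deriv (fun y => solM m₀ w (y, t)) x| ≤ C := by
  obtain ⟨n, rfl⟩ : ∃ n, k = n + 1 := ⟨k - 1, by omega⟩
  obtain ⟨r, hr⟩ := h.exists_solM_eq_zero τ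
  have hM := h.contDiffOn_solM hk hm hJ hJc h0 hpos
  push_cast at hM
  have hM' := contDiffOn_fderiv_apply hJ hM (1, 0)
  have hK : IsCompact (Metric.closedBall (0 : ℝ) r ×ˢ Icc 0 τ) :=
    (isCompact_closedBall 0 r).prod isCompact_Icc
  have hsub : Metric.closedBall (0 : ℝ) r ×ˢ Icc 0 τ ⊆ univ ×ˢ J := prod_mono (subset_univ _) hτ
  obtain ⟨C₁, hC₁⟩ := hK.exists_bound_of_continuousOn (hM.continuousOn.mono hsub)
  obtain ⟨C₂, hC₂⟩ := hK.exists_bound_of_continuousOn (hM'.continuousOn.mono hsub)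
  refine ⟨max 0 (max C₁ C₂), fun t ht x => ?_⟩
  have htτ : |t| ≤ τ := (abs_of_nonneg ht.1).trans_le ht.2
  rcases le_or_gt |x| r with hx | hx
  · have hmem : (x, t) ∈ Metric.closedBall (0 : ℝ) r ×ˢ Icc 0 τ := ⟨by simpa using hx, ht⟩
    rw [(hasDerivAt_fst_of_contDiffOn hJ hM (p := (x, t)) (hτ ht)).deriv]
    exact ⟨(hC₁ _ hmem).trans (by simp), (hC₂ _ hmem).trans (by simp)⟩
  · have hev : (fun y => solM m₀ w (y, t)) =ᶠ[𝓝 x] fun _ => 0 := by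
      filter_upwards [(isOpen_lt continuous_const continuous_abs).mem_nhds hx] with y hy
      exact hr t htτ y hy
    rw [hev.deriv_eq, hr t htτ x hx]
    simp

theorem exists_bound_solM_slice {t : ℝ} (ht : t ∈ J) : ∃ C, ∀ x, |solM m₀ w (x, t)| ≤ C :=
  (h.hasCompactSupport_solM t).exists_bound_of_continuous
    (h.continuous_solM hk hm hJ hJc h0 hpos ht)

theorem solU_eq {t : ℝ} (ht : t ∈ J) (x : ℝ) :
    solU m₀ w (x, t) =
      (lagR m₀ w (label m₀ w (x, t), t) + lagL m₀ w (label m₀ w (x, t), t)) / 2 := by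
  obtain ⟨C, hC⟩ := h.exists_bound_solM_slice hk hm hJ hJc h0 hpos ht
  obtain ⟨h1, h2⟩ := h.tails_solM (hpos t ht) x
  rw [solU, helmholtzInv_eq (h.continuous_solM hk hm hJ hJc h0 hpos ht) hC, h1, h2]

theorem hasDerivAt_solU {t : ℝ} (ht : t ∈ J) (x : ℝ) :
    HasDerivAt (fun x => solU m₀ w (x, t))
      ((lagR m₀ w (label m₀ w (x, t), t) - lagL m₀ w (label m₀ w (x, t), t)) / 2) x := by
  obtain ⟨C, hC⟩ := h.exists_bound_solM_slice hk hm hJ hJc h0 hpos ht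
  obtain ⟨h1, h2⟩ := h.tails_solM (hpos t ht) x
  rw [← h1, ← h2]
  exact hasDerivAt_helmholtzInv (h.continuous_solM hk hm hJ hJc h0 hpos ht) hC x

theorem hasDerivAt_deriv_solU {t : ℝ} (ht : t ∈ J) (x : ℝ) :
    HasDerivAt (deriv fun x => solU m₀ w (x, t)) (solU m₀ w (x, t) - solM m₀ w (x, t)) x := by
  obtain ⟨C, hC⟩ := h.exists_bound_solM_slice hk hm hJ hJc h0 hpos ht
  exact hasDerivAt_deriv_helmholtzInv (h.continuous_solM hk hm hJ hJc h0 hpos ht) hC x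

theorem isClassC_solM {T : ℝ≥0∞} (hT : timeInterval T ⊆ J) :
    IsClassC k 1 T fun x t => solM m₀ w (x, t) :=
  isClassC_of_contDiffOn hJ hT hk (h.contDiffOn_solM hk hm hJ hJc h0 hpos)

theorem isClassC_solU {T : ℝ≥0∞} (hT : timeInterval T ⊆ J) :
    IsClassC (k + 2) 1 T fun x t => solU m₀ w (x, t) := by
  obtain ⟨-, -, hR, hL⟩ := h.contDiffOn hm hJ hJc h0 hpos
  have hd := fun (p : ℝ × ℝ) (hp : p.2 ∈ J) => h.hasDerivAt_solU hk hm hJ hJc h0 hpos hp p.1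
  have hU : ContDiffOn ℝ k (solU m₀ w) (univ ×ˢ J) :=
    (h.contDiffOn_comp_label hk hm hJ hJc h0 hpos
      (f := fun p => (lagR m₀ w p + lagL m₀ w p) / 2) ((hR.add hL).div_const 2)).congr
      fun p hp => h.solU_eq hk hm hJ hJc h0 hpos hp.2 p.1
  refine isClassC_add_two_of_contDiffOn hJ hT hk hU
    (h.contDiffOn_comp_label hk hm hJ hJc h0 hpos
      (f := fun p => (lagR m₀ w p - lagL m₀ w p) / 2) ((hR.sub hL).div_const 2))
    (h.contDiffOn_solM hk hm hJ hJc h0 hpos) hd fun p hp => ?_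
  have he : (deriv fun x => solU m₀ w (x, p.2)) = _ := funext fun x => (hd (x, p.2) hp).deriv
  have := h.hasDerivAt_deriv_solU hk hm hJ hJc h0 hpos hp p.1
  rwa [he] at this

/-- The transported momentum solves the equation: this is the time derivative of
`m(X(ξ, t), t) w(ξ, t) = m₀(ξ)`. -/
theorem equation_solM {t : ℝ} (ht : t ∈ J) (x : ℝ) :
    deriv (fun s => solM m₀ w (x, s)) t + deriv (fun y => ((solU m₀ w (y, t)) ^ 2 -
      (deriv (fun z => solU m₀ w (z, t)) y) ^ 2) * solM m₀ w (y, t)) x = 0 := by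
  obtain ⟨n, rfl⟩ : ∃ n, k = n + 1 := ⟨k - 1, by omega⟩
  have hM := h.contDiffOn_solM hk hm hJ hJc h0 hpos
  push_cast at hM
  have hmx := hasDerivAt_fst_of_contDiffOn hJ hM (p := (x, t)) ht
  have hmt := hasDerivAt_snd_of_contDiffOn hJ hM (p := (x, t)) ht
  set mx := fderiv ℝ (solM m₀ w) (x, t) (1, 0)
  set mt := fderiv ℝ (solM m₀ w) (x, t) (0, 1)
  set ξ := label m₀ w (x, t) with hξ
  have hx : flow m₀ w (ξ, t) = x := h.flow_label (x, t)
  set R := lagR m₀ w (ξ, t)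
  set L := lagL m₀ w (ξ, t)
  have hu := h.solU_eq hk hm hJ hJc h0 hpos ht x
  have hux := h.hasDerivAt_solU hk hm hJ hJc h0 hpos ht x
  have huxx := h.hasDerivAt_deriv_solU hk hm hJ hJc h0 hpos ht x
  have hflux := (((hux.pow 2).sub (huxx.pow 2)).mul hmx).deriv
  have hcurve := hasDerivAt_along_curve (isOpen_univ.prod hJ)
    (fun p hp => hasDerivAt_fst_of_contDiffOn hJ hM hp.2)
    (fun p hp => hasDerivAt_snd_of_contDiffOn hJ hM hp.2)
    (contDiffOn_fderiv_apply hJ hM _).continuousOn (contDiffOn_fderiv_apply hJ hM _).continuousOn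
    (h.hasDerivAt_flow_time (ξ, t)) ⟨mem_univ _, ht⟩
  have hprod := hcurve.mul (h.hasDerivAt ξ t)
  have hconst : HasDerivAt (fun s => solM m₀ w (flow m₀ w (ξ, s), s) * w s ξ) 0 t := by
    refine (hasDerivAt_const t (m₀ ξ)).congr_of_eventuallyEq ?_
    filter_upwards [hJ.mem_nhds ht] with s hs using h.solM_flow_mul (hpos s hs) ξ
  have key := hprod.unique hconst
  have hm0 := h.solM_flow_mul (hpos t ht) ξ
  simp only [hx] at key hm0
  have hw := (hpos t ht ξ).ne'
  have key2 : mt + R * L * mx + solM m₀ w (x, t) ^ 2 * (R - L) = 0 := by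
    refine (mul_eq_zero.1 (?_ : _ * w t ξ = 0)).resolve_right hw
    rw [← key]
    linear_combination (solM m₀ w (x, t) * (R - L)) * hm0
  have e1 : deriv (fun y => ((solU m₀ w (y, t)) ^ 2 -
      (deriv (fun z => solU m₀ w (z, t)) y) ^ 2) * solM m₀ w (y, t)) x = _ := hflux
  have hd : deriv (fun z => solU m₀ w (z, t)) x = (R - L) / 2 := hux.deriv
  rw [hmt.deriv, e1]
  simp only [Pi.pow_apply, Pi.sub_apply, hd]
  rw [hu]
  linear_combination key2

end IsStretch

/-- The momentum transported by the flow is a classical solution on `[0, T)` as long as the stretch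
is positive there. -/
theorem IsStretch.isClassicalSolution {m₀ : ℝ → ℝ} {w : ℝ → (ℝ →ᵇ ℝ)} (h : IsStretch m₀ w) {k : ℕ}
    (hk : 1 ≤ k) (hm : ContDiff ℝ k m₀) {T : ℝ≥0∞} {J : Set ℝ} (hJ : IsOpen J)
    (hJc : J.OrdConnected) (h0 : (0 : ℝ) ∈ J) (hpos : ∀ t ∈ J, ∀ ξ, 0 < w t ξ)
    (hT : timeInterval T ⊆ J) :
    IsClassicalSolution k m₀ T (fun x t => solU m₀ w (x, t)) (fun x t => solM m₀ w (x, t)) where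
  regularity_u := h.isClassC_solU hk hm hJ hJc h0 hpos hT
  regularity_m := h.isClassC_solM hk hm hJ hJc h0 hpos hT
  bounded τ hτ := by
    obtain ⟨C, hC⟩ := h.exists_bound_solM hk hm hJ hJc h0 hpos (hJc.out h0 (hT hτ))
    exact ⟨C, fun t ht x => (hC t ht x).1⟩
  momentum t ht x := by
    rw [iteratedDeriv_succ, iteratedDeriv_one,
      (h.hasDerivAt_deriv_solU hk hm hJ hJc h0 hpos (hT ht) x).deriv]
    ring
  velocity t ht x := rfl
  equation t ht _ x := h.equation_solM hk hm hJ hJc h0 hpos (hT ht) x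
  initial := h.solM_zero

/-- The interval of times around `0` on which the stretch stays positive. -/
theorem IsStretch.exists_interval {m₀ : ℝ → ℝ} {w : ℝ → (ℝ →ᵇ ℝ)} (h : IsStretch m₀ w) :
    ∃ J : Set ℝ, IsOpen J ∧ J.OrdConnected ∧ (0 : ℝ) ∈ J ∧ (∀ t ∈ J, ∀ ξ, 0 < w t ξ) ∧
      ∀ T : ℝ≥0∞, (∀ t ∈ timeInterval T, ∀ ξ, 0 < w t ξ) → timeInterval T ⊆ J := by
  have h0 : (0 : ℝ) ∈ {t | ∀ ξ, 0 < w t ξ} := fun ξ => by rw [h.init]; exact one_pos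
  refine ⟨connectedComponentIn {t | ∀ ξ, 0 < w t ξ} 0, h.isOpen_pos.connectedComponentIn,
    isPreconnected_connectedComponentIn.ordConnected, mem_connectedComponentIn h0,
    fun t ht => connectedComponentIn_subset _ _ ht, fun T hT t ht => ?_⟩
  exact (isPreconnected_timeInterval T).subset_connectedComponentIn
    (Icc_subset_timeInterval ht ⟨le_rfl, ht.1⟩) hT ht

/-! ### Uniqueness of classical solutions -/

/-- Mean value inequality with differentiability in the interior only. -/
theorem abs_le_of_abs_hasDerivAt_le {f f' B B' : ℝ → ℝ} {t : ℝ} (ht : 0 ≤ t)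
    (hf : ContinuousOn f (Icc 0 t)) (hf' : ∀ s ∈ Ioo 0 t, HasDerivAt f (f' s) s)
    (hB : ContinuousOn B (Icc 0 t)) (hB' : ∀ s ∈ Ioo 0 t, HasDerivAt B (B' s) s)
    (hle : ∀ s ∈ Ioo 0 t, |f' s| ≤ B' s) (h0 : f 0 = 0) (hB0 : B 0 = 0) : |f t| ≤ B t := by
  have key : ∀ σ : ℝ, |σ| = 1 → 0 ≤ B t - σ * f t := by
    intro σ hσ
    have hmono : MonotoneOn (fun s => B s - σ * f s) (Icc 0 t) := by
      have hd : ∀ s ∈ Ioo 0 t, HasDerivAt (fun s => B s - σ * f s) (B' s - σ * f' s) s :=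
        fun s hs => (hB' s hs).sub ((hf' s hs).const_mul σ)
      refine monotoneOn_of_deriv_nonneg (convex_Icc 0 t)
        (hB.sub (continuousOn_const.mul hf)) ?_ ?_
      · rw [interior_Icc]
        exact fun s hs => (hd s hs).differentiableAt.differentiableWithinAt
      · rw [interior_Icc]
        intro s hs
        rw [(hd s hs).deriv]
        have h1 := le_abs_self (σ * f' s)
        rw [abs_mul, hσ, one_mul] at h1
        linarith [hle s hs]
    have := hmono ⟨le_rfl, ht⟩ ⟨ht, le_rfl⟩ ht
    simpa [h0, hB0] using this
  have h1 := key 1 (by simp)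
  have h2 := key (-1) (by simp)
  rw [abs_le]
  constructor <;> linarith

namespace IsClassicalSolution

variable {k : ℕ} {m₀ : ℝ → ℝ} {T : ℝ≥0∞} {u m : ℝ → ℝ → ℝ} (h : IsClassicalSolution k m₀ T u m)
include h

theorem continuous_slice {t : ℝ} (ht : t ∈ timeInterval T) : Continuous fun x => m x t :=
  (h.regularity_m.contDiff_space t ht).continuous

theorem exists_bound_slice {t : ℝ} (ht : t ∈ timeInterval T) : ∃ C, ∀ x, |m x t| ≤ C := by
  obtain ⟨C, hC⟩ := h.bounded t ht
  exact ⟨C, hC t ⟨ht.1, le_rfl⟩⟩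

theorem velocity_fun {t : ℝ} (ht : t ∈ timeInterval T) :
    (fun x => u x t) = helmholtzInv fun x => m x t := funext (h.velocity t ht)

theorem velocity_eq {t : ℝ} (ht : t ∈ timeInterval T) (x : ℝ) :
    u x t = (tailR id (fun y => m y t) x + tailL id (fun y => m y t) x) / 2 := by
  obtain ⟨C, hC⟩ := h.exists_bound_slice ht
  rw [h.velocity t ht, helmholtzInv_eq (h.continuous_slice ht) hC]

theorem hasDerivAt_velocity {t : ℝ} (ht : t ∈ timeInterval T) (x : ℝ) :
    HasDerivAt (fun x => u x t)
      ((tailR id (fun y => m y t) x - tailL id (fun y => m y t) x) / 2) x := by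
  obtain ⟨C, hC⟩ := h.exists_bound_slice ht
  rw [h.velocity_fun ht]
  exact hasDerivAt_helmholtzInv (h.continuous_slice ht) hC x

/-- The characteristic speed factors as `u² - u_x² = (u + u_x)(u - u_x)`. -/
theorem speed_eq {t : ℝ} (ht : t ∈ timeInterval T) (x : ℝ) :
    u x t ^ 2 - deriv (fun y => u y t) x ^ 2 =
      tailR id (fun y => m y t) x * tailL id (fun y => m y t) x := by
  rw [(h.hasDerivAt_velocity ht x).deriv, h.velocity_eq ht]
  ring

theorem hasDerivAt_speed {t : ℝ} (ht : t ∈ timeInterval T) (x : ℝ) :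
    HasDerivAt (fun x => u x t ^ 2 - deriv (fun y => u y t) x ^ 2)
      ((tailR id (fun y => m y t) x - tailL id (fun y => m y t) x) * m x t) x := by
  obtain ⟨C, hC⟩ := h.exists_bound_slice ht
  have he : (fun x => u x t ^ 2 - deriv (fun y => u y t) x ^ 2) = _ := funext (h.speed_eq ht)
  rw [he]
  refine ((hasDerivAt_tailR_id (h.continuous_slice ht) hC x).mul
    (hasDerivAt_tailL_id (h.continuous_slice ht) hC x)).congr_deriv ?_
  ring

theorem continuousOn_speed : ContinuousOn
    (fun p : ℝ × ℝ => u p.1 p.2 ^ 2 - deriv (fun y => u y p.2) p.1 ^ 2)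
    (univ ×ˢ timeInterval T) := by
  have h0 := h.regularity_u.continuousOn_space 0 (by omega)
  have h1 := h.regularity_u.continuousOn_space 1 (by omega)
  simp only [iteratedDeriv_zero, iteratedDeriv_one] at h0 h1
  exact (h0.pow 2).sub (h1.pow 2)

theorem continuousOn_momentum :
    ContinuousOn (fun p : ℝ × ℝ => m p.1 p.2) (univ ×ˢ timeInterval T) := by
  simpa using h.regularity_m.continuousOn_space 0 (by omega)

theorem hasDerivAt_momentum_space (hk : 1 ≤ k) {t : ℝ} (ht : t ∈ timeInterval T) (x : ℝ) :
    HasDerivAt (fun x => m x t) (deriv (fun x => m x t) x) x :=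
  ((h.regularity_m.contDiff_space t ht).differentiable
    (by exact_mod_cast (by omega : k ≠ 0)) x).hasDerivAt

theorem hasDerivAt_momentum_time {t : ℝ} (ht : t ∈ interior (timeInterval T)) (x : ℝ) :
    HasDerivAt (fun t => m x t) (derivWithin (fun t => m x t) (timeInterval T) t) t := by
  have h1 := ((h.regularity_m.contDiffOn_time x).differentiableOn (by simp))
    t (interior_subset ht)
  exact h1.hasDerivWithinAt.hasDerivAt (mem_interior_iff_mem_nhds.1 ht)

/-- The equation in nonconservative form. -/
theorem derivWithin_momentum_eq (hk : 1 ≤ k) {t : ℝ} (ht : t ∈ interior (timeInterval T))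
    (h0 : 0 < t) (x : ℝ) :
    derivWithin (fun t => m x t) (timeInterval T) t =
      -((tailR id (fun y => m y t) x - tailL id (fun y => m y t) x) * m x t ^ 2
        + tailR id (fun y => m y t) x * tailL id (fun y => m y t) x
          * deriv (fun x => m x t) x) := by
  have ht' := interior_subset ht
  have h1 := h.equation t ht' h0 x
  have h2 := ((h.hasDerivAt_speed ht' x).mul (h.hasDerivAt_momentum_space hk ht' x)).deriv
  have h3 : deriv (fun y => ((u y t) ^ 2 - (deriv (fun z => u z t) y) ^ 2) * m y t) x = _ := h2
  rw [h3, (h.hasDerivAt_momentum_time ht x).deriv, h.speed_eq ht'] at h1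
  linear_combination h1

theorem hasDerivAt_momentum_along_curve (hk : 1 ≤ k) {z : ℝ → ℝ} {z' t : ℝ}
    (hz : HasDerivAt z z' t) (ht : t ∈ interior (timeInterval T)) :
    HasDerivAt (fun s => m (z s) s) (derivWithin (fun s => m (z t) s) (timeInterval T) t
      + z' * deriv (fun x => m x t) (z t)) t := by
  have hsub : (univ : Set ℝ) ×ˢ interior (timeInterval T) ⊆ univ ×ˢ timeInterval T :=
    prod_mono_right interior_subset
  have c1 := (h.regularity_m.continuousOn_space 1 hk).mono hsub
  have c2 := (h.regularity_m.continuousOn_time 1 le_rfl).mono hsub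
  simp only [iteratedDeriv_one, iteratedDerivWithin_one] at c1 c2
  exact hasDerivAt_along_curve (isOpen_univ.prod isOpen_interior) (F := fun p => m p.1 p.2)
    (Fx := fun p => deriv (fun x => m x p.2) p.1)
    (Ft := fun p => derivWithin (fun t => m p.1 t) (timeInterval T) p.2)
    (fun p hp => h.hasDerivAt_momentum_space hk (interior_subset hp.2) p.1)
    (fun p hp => h.hasDerivAt_momentum_time hp.2 p.1) c1 c2 hz ⟨mem_univ _, ht⟩

/-- Through every point `(x, t)` passes a characteristic curve defined on `[0, t]`. -/
theorem exists_characteristic {t : ℝ} (ht : t ∈ timeInterval T) (x : ℝ) :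
    ∃ z : ℝ → ℝ, z t = x ∧ ∀ s ∈ Icc 0 t,
      HasDerivWithinAt z (u (z s) s ^ 2 - deriv (fun y => u y s) (z s) ^ 2) (Icc 0 t) s := by
  obtain ⟨C, hC⟩ := h.bounded t ht
  have hsub := Icc_subset_timeInterval ht
  have hC0 : 0 ≤ C := (abs_nonneg _).trans (hC t ⟨ht.1, le_rfl⟩ 0)
  have hR := fun s (hs : s ∈ Icc 0 t) y => abs_tailR_id_le (hC s hs) y
  have hL := fun s (hs : s ∈ Icc 0 t) y => abs_tailL_id_le (hC s hs) y
  have hP : IsPicardLindelof (fun s y => u y s ^ 2 - deriv (fun y => u y s) y ^ 2)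
      (⟨t, ht.1, le_rfl⟩ : Icc 0 t) x ((C * C).toNNReal * t.toNNReal) 0 (C * C).toNNReal
      (2 * C * C).toNNReal := by
    refine ⟨fun s hs => LipschitzWith.lipschitzOnWith ?_, fun y _ => ?_, fun s hs y _ => ?_, ?_⟩
    · refine lipschitzWith_of_nnnorm_deriv_le
        (fun y => (h.hasDerivAt_speed (hsub hs) y).differentiableAt) fun y => ?_
      rw [(h.hasDerivAt_speed (hsub hs) y).deriv, ← NNReal.coe_le_coe, coe_nnnorm,
        Real.coe_toNNReal _ (by positivity), norm_mul]
      refine mul_le_mul ((abs_sub _ _).trans ?_) (hC s hs y) (norm_nonneg _) (by positivity)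
      linarith [hR s hs y, hL s hs y]
    · exact h.continuousOn_speed.comp (f := fun s => (y, s)) (by fun_prop)
        fun s hs => ⟨mem_univ _, hsub hs⟩
    · rw [h.speed_eq (hsub hs), norm_mul, Real.coe_toNNReal _ (by positivity)]
      exact mul_le_mul (hR s hs y) (hL s hs y) (norm_nonneg _) hC0
    · simp [ht.1]
  obtain ⟨z, hz, hz'⟩ := hP.exists_eq_forall_mem_Icc_hasDerivWithinAt₀
  exact ⟨z, hz, hz'⟩

end IsClassicalSolution

/-- Uniqueness: a classical solution agrees with any classical solution whose momentum has a
locally bounded space derivative. Along the characteristics of the first solution the difference of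
the momenta changes at a rate bounded by its own supremum. -/
theorem IsClassicalSolution.momentum_unique {k : ℕ} (hk : 1 ≤ k) {m₀ : ℝ → ℝ} {T₁ T₂ : ℝ≥0∞}
    {u₁ m₁ u₂ m₂ : ℝ → ℝ → ℝ} (h₁ : IsClassicalSolution k m₀ T₁ u₁ m₁)
    (h₂ : IsClassicalSolution k m₀ T₂ u₂ m₂) {τ : ℝ}
    (hb : ∃ C, ∀ t ∈ Icc 0 τ, ∀ x, |deriv (fun y => m₂ y t) x| ≤ C)
    (hτ : τ ∈ timeInterval T₁) (hτ₂ : τ ∈ timeInterval T₂) (x : ℝ) : m₁ x τ = m₂ x τ := by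
  obtain ⟨C, hC1, hC2, hC3⟩ : ∃ C, (∀ t ∈ Icc 0 τ, ∀ x, |m₁ x t| ≤ C) ∧
      (∀ t ∈ Icc 0 τ, ∀ x, |m₂ x t| ≤ C) ∧
      ∀ t ∈ Icc 0 τ, ∀ x, |deriv (fun y => m₂ y t) x| ≤ C := by
    obtain ⟨C₁, h1⟩ := h₁.bounded τ hτ
    obtain ⟨C₂, h2⟩ := h₂.bounded τ hτ₂
    obtain ⟨C₃, h3⟩ := hb
    exact ⟨max C₁ (max C₂ C₃), fun t ht x => (h1 t ht x).trans (by simp),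
      fun t ht x => (h2 t ht x).trans (by simp), fun t ht x => (h3 t ht x).trans (by simp)⟩
  have hsub := Icc_subset_timeInterval hτ
  have hsub₂ := Icc_subset_timeInterval hτ₂
  have hC0 : 0 ≤ C := (abs_nonneg _).trans (hC1 τ ⟨hτ.1, le_rfl⟩ 0)
  have main : ∀ n : ℕ, ∀ t ∈ Icc 0 τ, ∀ x,
      |m₁ x t - m₂ x t| ≤ 2 * C * ((8 * C ^ 2 * t) ^ n / n.factorial) := by
    intro n
    induction n with
    | zero =>
      intro t ht x
      have := abs_sub (m₁ x t) (m₂ x t)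
      simp only [pow_zero, Nat.factorial_zero, Nat.cast_one, div_one, mul_one]
      linarith [hC1 t ht x, hC2 t ht x]
    | succ n ih =>
      intro t ht x
      obtain ⟨z, hzt, hz⟩ := h₁.exists_characteristic (hsub ht) x
      have hzc : ContinuousOn z (Icc 0 t) := fun s hs => (hz s hs).continuousWithinAt
      have hts : Icc 0 t ⊆ Icc 0 τ := Icc_subset_Icc_right ht.2
      have hint : ∀ {T : ℝ≥0∞}, Icc 0 τ ⊆ timeInterval T → ∀ s ∈ Ioo 0 t,
          s ∈ interior (timeInterval T) := fun hT s hs => mem_interior_iff_mem_nhds.2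
        (timeInterval_mem_nhds (hT (hts (Ioo_subset_Icc_self hs))) hs.1)
      have hmc : ∀ {T : ℝ≥0∞} {u m : ℝ → ℝ → ℝ}, Icc 0 τ ⊆ timeInterval T →
          IsClassicalSolution k m₀ T u m → ContinuousOn (fun s => m (z s) s) (Icc 0 t) :=
        fun hT hS => hS.continuousOn_momentum.comp (f := fun s => (z s, s))
          (hzc.prodMk continuousOn_id) fun s hs => ⟨mem_univ _, hT (hts hs)⟩
      have key := abs_le_of_abs_hasDerivAt_le ht.1 ((hmc hsub h₁).sub (hmc hsub₂ h₂))
        (fun s hs => (h₁.hasDerivAt_momentum_along_curve hk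
          ((hz s (Ioo_subset_Icc_self hs)).hasDerivAt (Icc_mem_nhds hs.1 hs.2)) (hint hsub s hs)).sub
          (h₂.hasDerivAt_momentum_along_curve hk
          ((hz s (Ioo_subset_Icc_self hs)).hasDerivAt (Icc_mem_nhds hs.1 hs.2)) (hint hsub₂ s hs)))
        (B := fun s => 2 * C * ((8 * C ^ 2 * s) ^ (n + 1) / (n + 1).factorial))
        (B' := fun s => 8 * C ^ 2 * (2 * C * ((8 * C ^ 2 * s) ^ n / n.factorial)))
        (by fun_prop) (fun s _ => ?_) (fun s hs => ?_) (by simp [h₁.initial, h₂.initial])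
        (by simp)
      · simpa [hzt] using key
      · have hp := ((((hasDerivAt_id s).const_mul (8 * C ^ 2)).pow (n + 1)).div_const
          ((n + 1).factorial : ℝ)).const_mul (2 * C)
        refine hp.congr_deriv ?_
        have hn : (n.factorial : ℝ) ≠ 0 := by positivity
        have hn1 : (n : ℝ) + 1 ≠ 0 := by positivity
        simp only [id, Nat.factorial_succ, Nat.cast_mul, Nat.cast_add, Nat.cast_one,
          Nat.add_sub_cancel]
        field_simp
      · have hs' := hts (Ioo_subset_Icc_self hs)
        have hsT := hsub hs'
        have hsT₂ := hsub₂ hs'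
        rw [h₁.derivWithin_momentum_eq hk (hint hsub s hs) hs.1,
          h₂.derivWithin_momentum_eq hk (hint hsub₂ s hs) hs.1, h₁.speed_eq hsT]
        set δ := 2 * C * ((8 * C ^ 2 * s) ^ n / n.factorial)
        have hδ : ∀ y, |m₁ y s - m₂ y s| ≤ δ := ih s hs'
        have eR := tailR_id_sub (h₁.continuous_slice hsT) (hC1 s hs') (h₂.continuous_slice hsT₂)
          (hC2 s hs') (z s)
        have eL := tailL_id_sub (h₁.continuous_slice hsT) (hC1 s hs') (h₂.continuous_slice hsT₂)
          (hC2 s hs') (z s)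
        have dR := abs_tailR_id_le hδ (z s)
        have dL := abs_tailL_id_le hδ (z s)
        rw [← eR] at dR
        rw [← eL] at dL
        have bR1 := abs_tailR_id_le (hC1 s hs') (z s)
        have bL1 := abs_tailL_id_le (hC1 s hs') (z s)
        have bR2 := abs_tailR_id_le (hC2 s hs') (z s)
        have bL2 := abs_tailL_id_le (hC2 s hs') (z s)
        have b1 := hC1 s hs' (z s)
        have b2 := hC2 s hs' (z s)
        have b3 := hC3 s hs' (z s)
        have dm := hδ (z s)
        generalize tailR id (fun y => m₁ y s) (z s) = R1 at *
        generalize tailL id (fun y => m₁ y s) (z s) = L1 at *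
        generalize tailR id (fun y => m₂ y s) (z s) = R2 at *
        generalize tailL id (fun y => m₂ y s) (z s) = L2 at *
        generalize deriv (fun x => m₁ x s) (z s) = D1 at *
        generalize deriv (fun x => m₂ x s) (z s) = D2 at *
        generalize m₁ (z s) s = a at *
        generalize m₂ (z s) s = b at *
        have hδ0 : 0 ≤ δ := (abs_nonneg _).trans dm
        have id1 : -((R1 - L1) * a ^ 2 + R1 * L1 * D1) + R1 * L1 * D1 -
            (-((R2 - L2) * b ^ 2 + R2 * L2 * D2) + R1 * L1 * D2) =
            -(((R1 - R2) - (L1 - L2)) * (a * a)) - ((R2 - L2) * ((a - b) * (a + b)))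
            - ((R1 - R2) * L1 + R2 * (L1 - L2)) * D2 := by ring
        rw [id1]
        have t1 : |((R1 - R2) - (L1 - L2)) * (a * a)| ≤ (δ + δ) * (C * C) := by
          rw [abs_mul, abs_mul]
          exact mul_le_mul ((abs_sub _ _).trans (add_le_add dR dL))
            (mul_le_mul b1 b1 (abs_nonneg _) hC0) (by positivity) (by positivity)
        have t2 : |(R2 - L2) * ((a - b) * (a + b))| ≤ (C + C) * (δ * (C + C)) := by
          rw [abs_mul, abs_mul]
          exact mul_le_mul ((abs_sub _ _).trans (add_le_add bR2 bL2))
            (mul_le_mul dm ((abs_add_le _ _).trans (add_le_add b1 b2)) (abs_nonneg _) hδ0)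
            (by positivity) (by positivity)
        have t3 : |((R1 - R2) * L1 + R2 * (L1 - L2)) * D2| ≤ (δ * C + C * δ) * C := by
          rw [abs_mul]
          refine mul_le_mul ((abs_add_le _ _).trans (add_le_add ?_ ?_)) b3 (abs_nonneg _)
            (by positivity)
          · rw [abs_mul]
            exact mul_le_mul dR bL1 (abs_nonneg _) hδ0
          · rw [abs_mul]
            exact mul_le_mul bR2 dL (abs_nonneg _) hC0
        have s1 := abs_sub (-(((R1 - R2) - (L1 - L2)) * (a * a)) - ((R2 - L2) * ((a - b) * (a + b))))
          (((R1 - R2) * L1 + R2 * (L1 - L2)) * D2)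
        have s2 := abs_sub (-(((R1 - R2) - (L1 - L2)) * (a * a))) ((R2 - L2) * ((a - b) * (a + b)))
        rw [abs_neg] at s2
        linarith
  have hlim : Tendsto (fun n : ℕ => 2 * C * ((8 * C ^ 2 * τ) ^ n / n.factorial)) atTop (𝓝 0) := by
    simpa using (FloorSemiring.tendsto_pow_div_factorial_atTop (8 * C ^ 2 * τ)).const_mul (2 * C)
  have h0 : |m₁ x τ - m₂ x τ| ≤ 0 :=
    ge_of_tendsto' hlim fun n => main n τ ⟨hτ.1, le_rfl⟩ x
  exact sub_eq_zero.1 (abs_nonpos_iff.1 h0)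

/-! ### The maximal existence time -/

theorem ofReal_abs_le_eLpNorm_top {f : ℝ → ℝ} (hf : Continuous f) (x : ℝ) :
    ENNReal.ofReal |f x| ≤ eLpNorm f ∞ volume := by
  have hae : ∀ᵐ y, ‖f y‖ₑ ≤ eLpNorm f ∞ volume := by
    rw [eLpNorm_exponent_top]
    exact enorm_ae_le_eLpNormEssSup f volume
  have hcl : IsClosed {y | ‖f y‖ₑ ≤ eLpNorm f ∞ volume} :=
    isClosed_le hf.enorm continuous_const
  have hx : x ∈ {y | ‖f y‖ₑ ≤ eLpNorm f ∞ volume} := by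
    have := (Measure.dense_of_ae hae).closure_eq
    rw [← hcl.closure_eq]
    exact this ▸ mem_univ x
  rwa [← Real.enorm_eq_ofReal_abs]

theorem eLpNorm_one_eq_ofReal {f : ℝ → ℝ} (hf : Integrable f) :
    eLpNorm f 1 volume = ENNReal.ofReal (∫ x, |f x|) := by
  rw [eLpNorm_one_eq_lintegral_enorm]
  exact (ofReal_integral_norm_eq_lintegral_enorm hf).symm

namespace IsStretch

variable {m₀ : ℝ → ℝ} {w : ℝ → (ℝ →ᵇ ℝ)} (h : IsStretch m₀ w)
include h

theorem continuous_time (ξ : ℝ) : Continuous fun t => w t ξ :=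
  continuous_iff_continuousAt.2 fun t => (h.hasDerivAt ξ t).continuousAt

theorem le_maxTime {k : ℕ} (hk : 1 ≤ k) (hm : ContDiff ℝ k m₀) {T : ℝ≥0∞}
    (hT : ∀ t ∈ timeInterval T, ∀ ξ, 0 < w t ξ) : T ≤ maxTime k m₀ := by
  obtain ⟨J, hJ, hJc, h0, hpos, hJT⟩ := h.exists_interval
  exact le_sSup ⟨_, _, h.isClassicalSolution hk hm hJ hJc h0 hpos (hJT T hT)⟩

/-- While the stretch is positive, every classical solution is the one carried by the flow. -/
theorem momentum_flow_mul {k : ℕ} (hk : 1 ≤ k) (hm : ContDiff ℝ k m₀) {T : ℝ≥0∞}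
    {u m : ℝ → ℝ → ℝ} (hS : IsClassicalSolution k m₀ T u m) {t : ℝ} (ht : t ∈ timeInterval T)
    (hw : ∀ s ∈ Icc 0 t, ∀ ξ, 0 < w s ξ) (ξ : ℝ) :
    m (flow m₀ w (ξ, t)) t * w t ξ = m₀ ξ := by
  obtain ⟨J, hJ, hJc, h0, hpos, hJT⟩ := h.exists_interval
  -- By openness the stretch is positive on a slightly longer time interval.
  obtain ⟨r, hr, hball⟩ := Metric.mem_nhds_iff.1 (h.isOpen_pos.mem_nhds (hw t ⟨ht.1, le_rfl⟩))
  have hT' : ∀ s ∈ timeInterval (ENNReal.ofReal (t + r)), ∀ ξ, 0 < w s ξ := by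
    intro s hs
    have hlt : s < t + r := (ENNReal.ofReal_lt_ofReal_iff_of_nonneg hs.1).1 hs.2
    rcases le_or_gt s t with hst | hst
    · exact hw s ⟨hs.1, hst⟩
    · refine hball ?_
      rw [Metric.mem_ball, Real.dist_eq, abs_of_pos (by linarith)]
      linarith
  have ht' : t ∈ timeInterval (ENNReal.ofReal (t + r)) :=
    ⟨ht.1, (ENNReal.ofReal_lt_ofReal_iff_of_nonneg ht.1).2 (by linarith)⟩
  have hJsub := hJT _ hT'
  have hL := h.isClassicalSolution hk hm hJ hJc h0 hpos hJsub
  obtain ⟨C, hC⟩ := h.exists_bound_solM hk hm hJ hJc h0 hpos (hJc.out h0 (hJsub ht'))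
  rw [hS.momentum_unique hk hL ⟨C, fun s hs x => (hC s hs x).2⟩ ht ht']
  exact h.solM_flow_mul (hw t ⟨ht.1, le_rfl⟩) ξ

/-- The stretch is positive as long as a classical solution exists: at its first zero the momentum
would be unbounded. -/
theorem pos_of_isClassicalSolution {k : ℕ} (hk : 1 ≤ k) (hm : ContDiff ℝ k m₀) {T : ℝ≥0∞}
    {u m : ℝ → ℝ → ℝ} (hS : IsClassicalSolution k m₀ T u m) :
    ∀ t ∈ timeInterval T, ∀ ξ, 0 < w t ξ := by
  intro t ht
  by_contra hnot
  set S : Set ℝ := Ici 0 ∩ {s | ∀ ξ, 0 < w s ξ}ᶜ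
  have hScl : IsClosed S := isClosed_Ici.inter h.isOpen_pos.isClosed_compl
  have hSb : BddBelow S := ⟨0, fun s hs => hs.1⟩
  have htS : t ∈ S := ⟨ht.1, hnot⟩
  set a := sInf S
  obtain ⟨ha0, haneg⟩ : a ∈ S := hScl.csInf_mem ⟨t, htS⟩ hSb
  have hbefore : ∀ s, 0 ≤ s → s < a → ∀ ξ, 0 < w s ξ := fun s hs hsa => by
    by_contra hc
    exact absurd (csInf_le hSb (⟨hs, hc⟩ : s ∈ S)) (not_le.2 hsa)
  have haT : a ∈ timeInterval T := Icc_subset_timeInterval ht ⟨ha0, csInf_le hSb htS⟩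
  obtain ⟨ξ, hξ⟩ : ∃ ξ, w a ξ ≤ 0 := by
    by_contra hc
    push Not at hc
    exact haneg hc
  have hapos : 0 < a := lt_of_le_of_ne ha0 fun he => by
    rw [← he, h.init] at hξ
    linarith
  obtain ⟨C, hC⟩ := hS.bounded a haT
  have hbound : ∀ s ∈ Ioo 0 a, |m₀ ξ| ≤ C * w s ξ := fun s hs => by
    have hsT := Icc_subset_timeInterval haT ⟨hs.1.le, hs.2.le⟩
    have hpos := hbefore s hs.1.le hs.2 ξ
    rw [← h.momentum_flow_mul hk hm hS hsT
      (fun r hr => hbefore r hr.1 (hr.2.trans_lt hs.2)) ξ, abs_mul, abs_of_pos hpos]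
    exact mul_le_mul_of_nonneg_right (hC s ⟨hs.1.le, hs.2.le⟩ _) hpos.le
  have hlim : |m₀ ξ| ≤ C * w a ξ := by
    have hcont : Tendsto (fun s => C * w s ξ) (𝓝[<] a) (𝓝 (C * w a ξ)) :=
      ((continuous_const.mul (h.continuous_time ξ)).tendsto a).mono_left nhdsWithin_le_nhds
    refine ge_of_tendsto hcont ?_
    filter_upwards [Ioo_mem_nhdsLT hapos] with s hs using hbound s hs
  have hC0 : 0 ≤ C := (abs_nonneg _).trans (hC a ⟨ha0, le_rfl⟩ 0)
  have hm0 : m₀ ξ = 0 := abs_nonpos_iff.1 (hlim.trans (mul_nonpos_of_nonneg_of_nonpos hC0 hξ))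
  rw [h.eq_one_of_eq_zero hm0] at hξ
  linarith

theorem pos_of_mem_maxTime {k : ℕ} (hk : 1 ≤ k) (hm : ContDiff ℝ k m₀) {t : ℝ}
    (ht : t ∈ timeInterval (maxTime k m₀)) : ∀ ξ, 0 < w t ξ := by
  obtain ⟨T, ⟨u, m, hS⟩, hT⟩ := lt_sSup_iff.1 ht.2
  exact h.pos_of_isClassicalSolution hk hm hS t ⟨ht.1, hT⟩

theorem exists_nonpos_at_maxTime {k : ℕ} (hk : 1 ≤ k) (hm : ContDiff ℝ k m₀)
    (hfin : maxTime k m₀ < ∞) : ∃ ξ, w (maxTime k m₀).toReal ξ ≤ 0 := by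
  by_contra hc
  push Not at hc
  set τ := (maxTime k m₀).toReal with hτ
  obtain ⟨r, hr, hball⟩ := Metric.mem_nhds_iff.1 (h.isOpen_pos.mem_nhds hc)
  have hτ0 : 0 ≤ τ := ENNReal.toReal_nonneg
  have hle : ENNReal.ofReal (τ + r) ≤ maxTime k m₀ := by
    refine h.le_maxTime hk hm fun s hs => ?_
    have hlt : s < τ + r := (ENNReal.ofReal_lt_ofReal_iff_of_nonneg hs.1).1 hs.2
    rcases lt_or_ge s τ with hst | hst
    · exact h.pos_of_mem_maxTime hk hm
        ⟨hs.1, (ENNReal.ofReal_lt_iff_lt_toReal hs.1 hfin.ne).2 hst⟩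
    · refine hball ?_
      rw [Metric.mem_ball, Real.dist_eq, abs_of_nonneg (by linarith)]
      linarith
  have := ENNReal.toReal_mono hfin.ne hle
  rw [ENNReal.toReal_ofReal (by linarith)] at this
  linarith

theorem blowsUp_of_maxTime_lt_top {k : ℕ} (hk : 1 ≤ k) (hm : ContDiff ℝ k m₀)
    (hfin : maxTime k m₀ < ∞) : BlowsUpInFiniteTime k m₀ := by
  refine ⟨hfin, ?_, fun u m hS => ?_⟩
  · obtain ⟨J, hJ, hJc, h0, hpos, hJT⟩ := h.exists_interval
    exact ⟨_, _, h.isClassicalSolution hk hm hJ hJc h0 hpos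
      (hJT _ fun t ht => h.pos_of_mem_maxTime hk hm ht)⟩
  obtain ⟨ξ, hξ⟩ := h.exists_nonpos_at_maxTime hk hm hfin
  set τ := (maxTime k m₀).toReal with hτ
  have hmem : ∀ s, 0 ≤ s → s < τ → s ∈ timeInterval (maxTime k m₀) := fun s hs hsτ =>
    ⟨hs, (ENNReal.ofReal_lt_iff_lt_toReal hs hfin.ne).2 hsτ⟩
  have hm0 : m₀ ξ ≠ 0 := fun h0 => by
    rw [h.eq_one_of_eq_zero h0] at hξ
    linarith
  have hτ0 : 0 < τ := lt_of_le_of_ne ENNReal.toReal_nonneg fun he => by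
    rw [← he, h.init] at hξ
    linarith
  have hev : ∀ᶠ s in 𝓝[<] τ, s ∈ Ioo 0 τ := Ioo_mem_nhdsLT hτ0
  have hpos : ∀ s ∈ Ioo 0 τ, ∀ ξ, 0 < w s ξ := fun s hs =>
    h.pos_of_mem_maxTime hk hm (hmem s hs.1.le hs.2)
  have hlim : Tendsto (fun s => w s ξ) (𝓝[<] τ) (𝓝 (w τ ξ)) :=
    ((h.continuous_time ξ).tendsto τ).mono_left nhdsWithin_le_nhds
  have hw0 : w τ ξ = 0 := le_antisymm hξ
    (ge_of_tendsto hlim (hev.mono fun s hs => (hpos s hs ξ).le))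
  rw [hw0] at hlim
  have hinv : Tendsto (fun s => |m₀ ξ| * (w s ξ)⁻¹) (𝓝[<] τ) atTop :=
    (tendsto_inv_nhdsGT_zero.comp (tendsto_nhdsWithin_iff.2
      ⟨hlim, hev.mono fun s hs => hpos s hs ξ⟩)).const_mul_atTop (abs_pos.2 hm0)
  have htop := ENNReal.tendsto_ofReal_atTop.comp hinv
  refine Tendsto.limsup_eq (tendsto_nhds_top_mono htop ?_)
  filter_upwards [hev] with s hs
  have hsT := hmem s hs.1.le hs.2
  have key := h.momentum_flow_mul hk hm hS hsT
    (fun r hr => h.pos_of_mem_maxTime hk hm (hmem r hr.1 (hr.2.trans_lt hs.2))) ξ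
  refine le_trans (le_of_eq ?_)
    (ofReal_abs_le_eLpNorm_top (hS.continuous_slice hsT) (flow m₀ w (ξ, s)))
  simp only [Function.comp_apply]
  rw [← key, abs_mul, abs_of_pos (hpos s hs ξ), mul_inv_cancel_right₀ (hpos s hs ξ).ne']

end IsStretch

/-! ### Bounds for the maximal existence time -/

theorem lower_bound_maxTime {k : ℕ} (hk : 1 ≤ k) {m₀ : ℝ → ℝ} (hm : ContDiff ℝ k m₀)
    (hs : HasCompactSupport m₀) :
    1 / (eLpNorm m₀ ∞ volume * eLpNorm m₀ 1 volume) ≤ maxTime k m₀ := by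
  obtain ⟨w, h⟩ := exists_isStretch hm.continuous hs
  refine h.le_maxTime hk hm fun t ht ξ => ?_
  have hfin : eLpNorm m₀ ∞ volume ≠ ∞ :=
    (hm.continuous.memLp_top_of_hasCompactSupport hs volume).eLpNorm_ne_top
  have h1 := ht.2
  rw [eLpNorm_one_eq_ofReal h.integrable] at h1
  set M := ∫ θ, |m₀ θ|
  have hM0 : 0 ≤ M := integral_nonneg fun _ => abs_nonneg _
  replace h1 := ENNReal.mul_lt_of_lt_div h1
  have h2 := (ENNReal.toReal_lt_toReal h1.ne_top ENNReal.one_ne_top).2 h1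
  rw [ENNReal.toReal_mul, ENNReal.toReal_mul, ENNReal.toReal_ofReal ht.1,
    ENNReal.toReal_ofReal hM0, ENNReal.toReal_one] at h2
  have h3 : |m₀ ξ| ≤ (eLpNorm m₀ ∞ volume).toReal :=
    (ENNReal.ofReal_le_iff_le_toReal hfin).1 (ofReal_abs_le_eLpNorm_top hm.continuous ξ)
  have h4 := intervalIntegral.norm_integral_le_of_norm_le_const (a := 0) (b := t)
    (f := fun s => lagR m₀ w (ξ, s) - lagL m₀ w (ξ, s)) fun s _ => h.abs_sub_le (ξ, s)
  rw [sub_zero, abs_of_nonneg ht.1] at h4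
  have h5 := mul_le_mul h3 h4 (norm_nonneg _) ENNReal.toReal_nonneg
  rw [← Real.norm_eq_abs, ← norm_mul] at h5
  have h6 := neg_abs_le (m₀ ξ * ∫ s in (0 : ℝ)..t, (lagR m₀ w (ξ, s) - lagL m₀ w (ξ, s)))
  rw [h.eq_one_add]
  rw [Real.norm_eq_abs] at h5
  nlinarith

/-- Under the blow-up criterion at `ξ`, with `β = |∂ₓu₀(ξ)|`, the stretch at `ξ` would be negative
at time `2β / ‖m₀‖₁³ ≤ 1 / ‖m₀‖₁²`, because `u_x` along the flow moves at most at speed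
`‖m₀‖₁³ / 4`. -/
theorem maxTime_le_of_criterion {k : ℕ} (hk : 1 ≤ k) {m₀ : ℝ → ℝ} (hm : ContDiff ℝ k m₀)
    (hs : HasCompactSupport m₀) {ξ : ℝ} (h1 : m₀ ξ * deriv (helmholtzInv m₀) ξ < 0)
    (h2 : |m₀ ξ| * (deriv (helmholtzInv m₀) ξ) ^ 2 > 1 / 2 * (eLpNorm m₀ 1 volume).toReal ^ 3) :
    maxTime k m₀ ≤ 1 / (eLpNorm m₀ 1 volume) ^ 2 ∧ eLpNorm m₀ 1 volume ≠ 0 := by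
  obtain ⟨w, h⟩ := exists_isStretch hm.continuous hs
  rw [eLpNorm_one_eq_ofReal h.integrable] at h2 ⊢
  have hab0 := h.abs_sub_le (ξ, 0)
  set M := ∫ θ, |m₀ θ| with hM
  have hM0 : 0 ≤ M := integral_nonneg fun _ => abs_nonneg _
  rw [ENNReal.toReal_ofReal hM0] at h2
  obtain ⟨C, hC⟩ := hs.exists_bound_of_continuous hm.continuous
  set D : ℝ → ℝ := fun s => lagR m₀ w (ξ, s) - lagL m₀ w (ξ, s) with hD
  have hDc : Continuous D := (h.continuous_lagR.comp (by fun_prop)).sub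
    (h.continuous_lagL.comp (by fun_prop))
  have hw0 : ∀ ξ, 0 ≤ w 0 ξ := fun ξ => by
    rw [h.init]
    exact zero_le_one
  have hD0 : deriv (helmholtzInv m₀) ξ = D 0 / 2 := by
    have hid : (fun ξ => flow m₀ w (ξ, 0)) = id := funext fun ξ => by simp [flow]
    rw [deriv_helmholtzInv hm.continuous hC, hD]
    simp only
    rw [h.lagR_eq hw0, h.lagL_eq hw0, hid]
  rw [hD0] at h1 h2
  set a := |m₀ ξ| with ha
  set b := |D 0| with hb
  have hab : m₀ ξ * D 0 = -(a * b) := by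
    rw [ha, hb, ← abs_mul, abs_of_neg (by linarith), neg_neg]
  have ha0 : 0 ≤ a := abs_nonneg _
  have hbpos : 0 < b := abs_pos.2 fun h0 => by simp [h0] at h1
  have hMpos : 0 < M := hbpos.trans_le hab0
  have hb2 : (D 0 / 2) ^ 2 = b ^ 2 / 4 := by rw [hb, div_pow, sq_abs]; norm_num
  rw [hb2] at h2
  set t₁ := b / M ^ 3 with ht₁
  have ht₁0 : 0 < t₁ := by positivity
  have ht₁M : M ^ 3 * t₁ = b := by rw [ht₁]; field_simp
  refine ⟨le_trans (b := ENNReal.ofReal t₁) ?_ ?_, by simpa using hMpos⟩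
  · by_contra hlt
    push Not at hlt
    have hpos : ∀ s ∈ Icc 0 t₁, ∀ ξ, 0 < w s ξ := fun s hs =>
      h.pos_of_mem_maxTime hk hm (Icc_subset_timeInterval ⟨ht₁0.le, hlt⟩ hs)
    have hDs : ∀ s ∈ Icc 0 t₁, |D s - D 0| ≤ M ^ 3 / 2 * s := by
      intro s hs
      have key := abs_tails_sub_add_le (g := m₀) (ξ := ξ) (δ := M ^ 2 / 2 * s)
        (monotone_stretchPrimitive (w s).continuous)
        (continuous_stretchPrimitive (w s).continuous)
        (monotone_stretchPrimitive (w 0).continuous)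
        (continuous_stretchPrimitive (w 0).continuous) h.integrable (fun θ _ => by
          rw [h.stretchPrimitive_sub_eq (fun ξ => (hpos s hs ξ).le), h.stretchPrimitive_sub_eq hw0]
          have e1 := h.abs_flow_sub_le (θ, s)
          have e2 := h.abs_flow_sub_le (ξ, s)
          have e3 : ∀ x, flow m₀ w (x, 0) = x := fun x => by simp [flow]
          rw [e3, e3]
          simp only [abs_of_nonneg hs.1] at e1 e2
          have e4 := abs_sub (flow m₀ w (θ, s) - θ) (flow m₀ w (ξ, s) - ξ)
          rw [show flow m₀ w (θ, s) - flow m₀ w (ξ, s) - (θ - ξ)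
            = flow m₀ w (θ, s) - θ - (flow m₀ w (ξ, s) - ξ) by ring]
          linarith)
      have e5 := abs_sub (lagR m₀ w (ξ, s) - lagR m₀ w (ξ, 0)) (lagL m₀ w (ξ, s) - lagL m₀ w (ξ, 0))
      have e6 : D s - D 0 = lagR m₀ w (ξ, s) - lagR m₀ w (ξ, 0)
        - (lagL m₀ w (ξ, s) - lagL m₀ w (ξ, 0)) := by simp only [hD]; ring
      rw [e6]
      refine e5.trans (key.trans (le_of_eq ?_))
      rw [← hM]
      ring
    have hint : m₀ ξ * ∫ s in (0 : ℝ)..t₁, D s ≤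
        ∫ s in (0 : ℝ)..t₁, (-(a * b) + a * (M ^ 3 / 2) * s) := by
      rw [← intervalIntegral.integral_const_mul]
      refine intervalIntegral.integral_mono_on ht₁0.le
        (Continuous.intervalIntegrable (by fun_prop) _ _)
        (Continuous.intervalIntegrable (by fun_prop) _ _) fun s hs => ?_
      have e1 := le_abs_self (m₀ ξ * (D s - D 0))
      rw [abs_mul] at e1
      have e2 := mul_le_mul_of_nonneg_left (hDs s hs) ha0
      linarith
    rw [intervalIntegral.integral_add (by simp) (Continuous.intervalIntegrable (by fun_prop) _ _),
      intervalIntegral.integral_const_mul, integral_id, intervalIntegral.integral_const] at hint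
    simp only [sub_zero, smul_eq_mul] at hint
    have hw := hpos t₁ ⟨ht₁0.le, le_rfl⟩ ξ
    rw [h.eq_one_add] at hw
    have e7 : M ^ 3 < 2 * (a * (b ^ 2 / 4)) := by linarith
    have e8 : 0 < 1 - 3 / 4 * (a * b * t₁) := by
      have : a * (M ^ 3 / 2) * ((t₁ ^ 2 - 0 ^ 2) / 2) = a * b * t₁ / 4 := by
        rw [← ht₁M]
        ring
      rw [this] at hint
      linarith
    have e9 : a * b * t₁ * M ^ 3 = a * b ^ 2 := by
      rw [← ht₁M]
      ring
    have hM3 : 0 < M ^ 3 := by positivity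
    nlinarith
  · have e1 : t₁ ≤ (M ^ 2)⁻¹ := by
      rw [ht₁, div_le_iff₀ (by positivity)]
      have : (M ^ 2)⁻¹ * M ^ 3 = M := by field_simp
      rw [this]
      exact hab0
    rw [one_div, ← ENNReal.ofReal_pow hM0, ← ENNReal.ofReal_inv_of_pos (by positivity)]
    exact ENNReal.ofReal_le_ofReal e1

theorem eLpNorm_const_mul_of_pos {f : ℝ → ℝ} {ε : ℝ} (hε : 0 < ε) (p : ℝ≥0∞) :
    eLpNorm (fun x => ε * f x) p volume = ENNReal.ofReal ε * eLpNorm f p volume := by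
  have := eLpNorm_const_smul (μ := volume) (p := p) ε f
  rw [Real.enorm_eq_ofReal hε.le] at this
  exact this

theorem helmholtzInv_const_mul (ε : ℝ) (f : ℝ → ℝ) :
    helmholtzInv (fun x => ε * f x) = fun x => ε * helmholtzInv f x := by
  ext x
  unfold helmholtzInv
  rw [← integral_const_mul]
  congr 1
  ext y
  ring

theorem one_div_ofReal_sq_mul {ε : ℝ} (hε : 0 < ε) (c : ℝ≥0∞) :
    1 / (ENNReal.ofReal ε ^ 2 * c) = 1 / c * ENNReal.ofReal (1 / ε ^ 2) := by
  have h1 : ENNReal.ofReal ε ^ 2 ≠ 0 := by simpa using hε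
  have h2 : ENNReal.ofReal ε ^ 2 ≠ ∞ := by simp
  rw [one_div, one_div, one_div, ENNReal.mul_inv (Or.inl h1) (Or.inl h2),
    ENNReal.ofReal_inv_of_pos (by positivity), ENNReal.ofReal_pow hε.le, mul_comm]

end MCH


theorem theorem1p2 (k : ℕ) (hk : 1 ≤ k) (m₀ : ℝ → ℝ)
    (hm₀ : ContDiff ℝ k m₀) (hsupp : HasCompactSupport m₀) :
    1 / (eLpNorm m₀ ∞ volume * eLpNorm m₀ 1 volume) ≤ MCH.maxTime k m₀ ∧
    ((∃ ξ : ℝ, m₀ ξ * deriv (MCH.helmholtzInv m₀) ξ < 0 ∧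
        |m₀ ξ| * (deriv (MCH.helmholtzInv m₀) ξ) ^ 2
          > 1 / 2 * (eLpNorm m₀ 1 volume).toReal ^ 3) →
      MCH.BlowsUpInFiniteTime k m₀ ∧
      ∀ ε : ℝ, 0 < ε →
        1 / (eLpNorm m₀ ∞ volume * eLpNorm m₀ 1 volume) * ENNReal.ofReal (1 / ε ^ 2)
            ≤ MCH.maxTime k (fun x => ε * m₀ x) ∧
        MCH.maxTime k (fun x => ε * m₀ x)
            ≤ 1 / (eLpNorm m₀ 1 volume) ^ 2 * ENNReal.ofReal (1 / ε ^ 2)) := by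
  refine ⟨MCH.lower_bound_maxTime hk hm₀ hsupp, ?_⟩
  rintro ⟨ξ, h1, h2⟩
  obtain ⟨w, h⟩ := MCH.exists_isStretch hm₀.continuous hsupp
  obtain ⟨hle, hne⟩ := MCH.maxTime_le_of_criterion hk hm₀ hsupp h1 h2
  refine ⟨h.blowsUp_of_maxTime_lt_top hk hm₀ (hle.trans_lt ?_), fun ε hε => ?_⟩
  · rw [one_div]
    exact ENNReal.inv_lt_top.2 (by positivity)
  have hmε : ContDiff ℝ k fun x => ε * m₀ x := contDiff_const.mul hm₀
  have hsε : HasCompactSupport fun x => ε * m₀ x := hsupp.mul_left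
  have hderiv : deriv (MCH.helmholtzInv fun x => ε * m₀ x) ξ
      = ε * deriv (MCH.helmholtzInv m₀) ξ := by
    rw [MCH.helmholtzInv_const_mul, deriv_const_mul_field]
  constructor
  · have := MCH.lower_bound_maxTime hk hmε hsε
    rw [MCH.eLpNorm_const_mul_of_pos hε, MCH.eLpNorm_const_mul_of_pos hε] at this
    rw [← MCH.one_div_ofReal_sq_mul hε]
    convert this using 2
    ring
  · -- Both inequalities of the criterion are homogeneous in the datum.
    have := (MCH.maxTime_le_of_criterion hk hmε hsε (ξ := ξ) (by
      rw [hderiv]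
      have := mul_neg_of_pos_of_neg (mul_pos hε hε) h1
      linarith) (by
      rw [hderiv, MCH.eLpNorm_const_mul_of_pos hε, ENNReal.toReal_mul,
        ENNReal.toReal_ofReal hε.le, abs_mul, abs_of_pos hε]
      have := mul_lt_mul_of_pos_left h2 (pow_pos hε 3)
      linarith)).1
    rw [MCH.eLpNorm_const_mul_of_pos hε, mul_pow, MCH.one_div_ofReal_sq_mul hε] at this
    exact this
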